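/- Let $n\ge 1$, let $\omega$ be a primitive $8$th root of unity, and put $X=\begin{bmatrix}0&1\\1&0\end{bmatrix}$, $Z=\begin{bmatrix}1&0\\0&-1\end{bmatrix}$, $H=\frac1{\sqrt2}\begin{bmatrix}1&1\\1&-1\end{bmatrix}$, $S=\begin{bmatrix}1&0\\0&\omega^2\end{bmatrix}$, $CZ=\mathrm{diag}(1,1,1,-1)$. For a $2\times 2$ matrix $U$ let $U_i$ denote $U$ acting on the $i$-th factor of $(\mathbb C^2)^{\otimes n}$, and let $CZ_{i\to i+1}$ denote $CZ$ acting on the factors $i,i+1$. Let $\mathrm{Pauli}_n=\langle X_1,\dots,X_n,Z_1,\dots,Z_n,\omega^2 I\rangle$, let $\mathrm{Cliff}_n$ be the normalizer of $\mathrm{Pauli}_n$ in the unitary group $U(2^n)$, and let $\mathcal C_n$ be the projective Clifford group, i.e. $\mathrm{Cliff}_n$ modulo all its scalar matrices (global phases), where products in $\mathcal C_n$ are written from left to right (opposite to matrix multiplication). Let $h_i,s_i,\Lambda_i\in\mathcal C_n$ be the classes of $H_i$, $S_i$, $CZ_{i\to i+1}$. For $n\ge2$ put $M=h_2\Lambda_1s_2^2h_2h_1s_1^2h_2\Lambda_1h_2$,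 and define the subgroups $$\mathcal{IN}_n=\begin{cases}\langle h_1,\;s_1^3h_1s_1h_1s_1\rangle,&n=1,\\ \langle h_1,h_2,s_2,h_1s_1^2h_1,M\rangle,&n=2,\\ \langle h_1,\dots,h_n,s_2,\dots,s_n,M,\Lambda_2,\dots,\Lambda_{n-1}\rangle,&n\ge3,\end{cases}$$ $$F_n=\begin{cases}\langle s_1^3h_1s_1h_1s_1\rangle,&n=1,\\ \langle h_2,s_2,s_1^3h_1s_1h_1s_1,M\rangle,&n=2,\\ \langle h_2,\dots,h_n,s_2,\dots,s_n,M,\Lambda_2,\dots,\Lambda_{n-1}\rangle,&n\ge3.\end{cases}$$ Theorem. The centralizer of $s_1$ in $\mathcal C_n$ is $$\mathrm{Cent}_{\mathcal C_n}(s_1)=\begin{cases}\langle s_1\rangle,&n=1,\\ \langle h_2,\dots,h_n,\;s_1,\dots,s_n,\;\Lambda_1,\dots,\Lambda_{n-1}\rangle,&n\ge2,\end{cases}$$ and for $n\ge 2$ the generator $s_1$ can be omitted. It is conjugate to $F_n$ in $\mathcal C_n$; in particular $\mathrm{Cent}_{\mathcal C_n}(s_1)=h_1s_1F_ns_1^3h_1$.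 Moreover $\mathcal{IN}_n$ is finite, $F_n$ is a normal subgroup of $\mathcal{IN}_n$ of index $2$, and hence $|\mathrm{Cent}_{\mathcal C_n}(s_1)|=|\mathcal{IN}_n|/2$. -/

import Mathlib

namespace QubitClifford

noncomputable section

/-- Labels of the computational basis of `n` qubits. The qubits are labelled by `Fin n`,
so qubit `1` of the usual numbering is `0 : Fin n`. -/
abbrev Basis (n : ℕ) : Type := Fin n → Fin 2

/-- The `2 ^ n × 2 ^ n` unitary matrices. -/
abbrev U (n : ℕ) := Matrix.unitaryGroup (Basis n) ℂ

/-- The primitive eighth roots of unity. -/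
abbrev EighthRoot : Type := {z : ℂ // IsPrimitiveRoot z 8}

/-! ### One-qubit matrices -/

/-- The Pauli matrix `X`. -/
def matX : Matrix (Fin 2) (Fin 2) ℂ := !![0, 1; 1, 0]

/-- The Pauli matrix `Z`. -/
def matZ : Matrix (Fin 2) (Fin 2) ℂ := !![1, 0; 0, -1]

/-- The Hadamard matrix. -/
def matH : Matrix (Fin 2) (Fin 2) ℂ := (1 / (Real.sqrt 2 : ℂ)) • !![1, 1; 1, -1]

/-- The phase matrix `diag(1, ω²)`. -/
def matS (ω : EighthRoot) : Matrix (Fin 2) (Fin 2) ℂ := !![1, 0; 0, (ω : ℂ) ^ 2]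

/-! ### Gates on `n` qubits -/

/-- The tensor product `f 0 ⊗ f 1 ⊗ ⋯ ⊗ f (n - 1)` of `2 × 2` matrices. -/
def tensorMat {n : ℕ} (f : Fin n → Matrix (Fin 2) (Fin 2) ℂ) : Matrix (Basis n) (Basis n) ℂ :=
  Matrix.of fun x y => ∏ k, f k (x k) (y k)

/-- The matrix `I ⊗ ⋯ ⊗ I ⊗ A ⊗ I ⊗ ⋯ ⊗ I` with `A` in position `i`. -/
def onQubit {n : ℕ} (i : Fin n) (A : Matrix (Fin 2) (Fin 2) ℂ) : Matrix (Basis n) (Basis n) ℂ :=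
  tensorMat (Function.update (fun _ => 1) i A)

/-- The controlled `Z` matrix on the qubits `i` and `j`: it multiplies a basis vector by `-1` if
both qubits are in state `1`, and fixes it otherwise. -/
def matCZ {n : ℕ} (i j : Fin n) : Matrix (Basis n) (Basis n) ℂ :=
  Matrix.diagonal fun x => if x i = 1 ∧ x j = 1 then -1 else 1

theorem tensorMat_mul {n : ℕ} (f g : Fin n → Matrix (Fin 2) (Fin 2) ℂ) :
    tensorMat f * tensorMat g = tensorMat fun k => f k * g k := by
  ext x y
  simp only [tensorMat, Matrix.mul_apply, Matrix.of_apply, ← Finset.prod_mul_distrib]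
  rw [Finset.prod_univ_sum]
  simp

theorem tensorMat_one {n : ℕ} :
    tensorMat (fun _ : Fin n => (1 : Matrix (Fin 2) (Fin 2) ℂ)) = 1 := by
  ext x y
  simp only [tensorMat, Matrix.of_apply, Matrix.one_apply]
  by_cases h : x = y
  · simp [h]
  · obtain ⟨k, hk⟩ := Function.ne_iff.mp h
    rw [if_neg h]
    exact Finset.prod_eq_zero (Finset.mem_univ k) (if_neg hk)

theorem tensorMat_star {n : ℕ} (f : Fin n → Matrix (Fin 2) (Fin 2) ℂ) :
    star (tensorMat f) = tensorMat fun k => star (f k) := by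
  ext x y
  simp [tensorMat, Matrix.star_apply]

theorem onQubit_one {n : ℕ} (i : Fin n) : onQubit i 1 = 1 := by
  rw [← tensorMat_one (n := n), onQubit]
  congr 1
  funext k
  by_cases h : k = i
  · subst h; simp
  · simp [h]

theorem onQubit_mul {n : ℕ} (i : Fin n) (A B : Matrix (Fin 2) (Fin 2) ℂ) :
    onQubit i A * onQubit i B = onQubit i (A * B) := by
  rw [onQubit, onQubit, onQubit, tensorMat_mul]
  congr 1
  funext k
  by_cases h : k = i
  · subst h; simp
  · simp [h]

theorem onQubit_comm {n : ℕ} {i j : Fin n} (hij : i ≠ j) (A B : Matrix (Fin 2) (Fin 2) ℂ) :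
    onQubit i A * onQubit j B = onQubit j B * onQubit i A := by
  rw [onQubit, onQubit, tensorMat_mul, tensorMat_mul]
  congr 1
  funext k
  by_cases h : k = i
  · subst h; simp [hij]
  · simp [h]

theorem onQubit_star {n : ℕ} (i : Fin n) (A : Matrix (Fin 2) (Fin 2) ℂ) :
    star (onQubit i A) = onQubit i (star A) := by
  rw [onQubit, onQubit, tensorMat_star]
  congr 1
  funext k
  by_cases h : k = i
  · subst h; simp
  · simp [h]

theorem onQubit_apply {n : ℕ} (i : Fin n) (A : Matrix (Fin 2) (Fin 2) ℂ) (x y : Basis n) :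
    onQubit i A x y = if ∀ k, k ≠ i → x k = y k then A (x i) (y i) else 0 := by
  simp only [onQubit, tensorMat, Matrix.of_apply]
  split_ifs with h
  · rw [Finset.prod_eq_single i]
    · simp
    · intro k _ hk
      simp [hk, h k hk]
    · simp
  · push Not at h
    obtain ⟨k, hk, hxy⟩ := h
    refine Finset.prod_eq_zero (Finset.mem_univ k) ?_
    simp [hk, hxy]

theorem onQubit_smul {n : ℕ} (i : Fin n) (c : ℂ) (A : Matrix (Fin 2) (Fin 2) ℂ) :
    onQubit i (c • A) = c • onQubit i A := by
  ext x y
  simp only [Matrix.smul_apply, onQubit_apply]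
  split_ifs <;> simp

theorem onQubit_mem {n : ℕ} (i : Fin n) {A : Matrix (Fin 2) (Fin 2) ℂ}
    (hA : A ∈ Matrix.unitaryGroup (Fin 2) ℂ) : onQubit i A ∈ Matrix.unitaryGroup (Basis n) ℂ := by
  rw [Matrix.mem_unitaryGroup_iff] at hA ⊢
  rw [onQubit_star, onQubit_mul, hA, onQubit_one]

theorem EighthRoot.pow_four (ω : EighthRoot) : (ω : ℂ) ^ 4 = -1 := by
  have h8 : (ω : ℂ) ^ 8 = 1 := ω.2.pow_eq_one
  have h4 : (ω : ℂ) ^ 4 ≠ 1 := ω.2.pow_ne_one_of_pos_of_lt (by norm_num) (by norm_num)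
  have h : ((ω : ℂ) ^ 4 - 1) * ((ω : ℂ) ^ 4 + 1) = 0 := by linear_combination h8
  rcases mul_eq_zero.mp h with h | h
  · exact absurd (sub_eq_zero.mp h) h4
  · exact eq_neg_of_add_eq_zero_left h

theorem EighthRoot.mul_star (ω : EighthRoot) :
    (ω : ℂ) ^ 2 * (starRingEnd ℂ) ((ω : ℂ) ^ 2) = 1 := by
  have h : ‖(ω : ℂ)‖ = 1 := ω.2.norm'_eq_one (by norm_num)
  rw [Complex.mul_conj, Complex.normSq_eq_norm_sq, norm_pow, h]
  norm_num

theorem matX_mem : matX ∈ Matrix.unitaryGroup (Fin 2) ℂ := by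
  rw [Matrix.mem_unitaryGroup_iff]
  ext i j
  fin_cases i <;> fin_cases j <;> simp [matX, Matrix.mul_apply, Fin.sum_univ_two]

theorem matZ_mem : matZ ∈ Matrix.unitaryGroup (Fin 2) ℂ := by
  rw [Matrix.mem_unitaryGroup_iff]
  ext i j
  fin_cases i <;> fin_cases j <;> simp [matZ, Matrix.mul_apply, Fin.sum_univ_two]

theorem sqrt_two_sq : ((Real.sqrt 2 : ℂ))⁻¹ * ((Real.sqrt 2 : ℂ))⁻¹ = 1 / 2 := by
  rw [← mul_inv, ← Complex.ofReal_mul, Real.mul_self_sqrt (by norm_num)]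
  norm_num

theorem matH_mul_self : matH * matH = 1 := by
  have h := sqrt_two_sq
  ext i j
  fin_cases i <;> fin_cases j <;>
    simp [matH, Matrix.mul_apply, Fin.sum_univ_two, h] <;> norm_num

theorem matH_mem : matH ∈ Matrix.unitaryGroup (Fin 2) ℂ := by
  have h : star matH = matH := by
    ext i j
    fin_cases i <;> fin_cases j <;> simp [matH, Matrix.star_apply]
  rw [Matrix.mem_unitaryGroup_iff, h, matH_mul_self]

theorem matS_mem (ω : EighthRoot) : matS ω ∈ Matrix.unitaryGroup (Fin 2) ℂ := by
  have h := ω.mul_star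
  rw [map_pow] at h
  rw [Matrix.mem_unitaryGroup_iff]
  ext i j
  fin_cases i <;> fin_cases j <;> simp [matS, Matrix.mul_apply, Fin.sum_univ_two, h]

theorem matCZ_mul_self {n : ℕ} (i j : Fin n) : matCZ i j * matCZ i j = 1 := by
  rw [matCZ, Matrix.diagonal_mul_diagonal, ← Matrix.diagonal_one]
  congr 1
  funext x
  split_ifs <;> norm_num

theorem matCZ_mem {n : ℕ} (i j : Fin n) : matCZ i j ∈ Matrix.unitaryGroup (Basis n) ℂ := by
  have h : star (matCZ i j) = matCZ i j := by
    rw [matCZ, Matrix.star_eq_conjTranspose, Matrix.diagonal_conjTranspose]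
    congr 1
    funext x
    simp only [Pi.star_apply]
    split_ifs <;> simp
  rw [Matrix.mem_unitaryGroup_iff, h, matCZ_mul_self]

/-- The unitary gate `X` on qubit `i`. -/
def gateX {n : ℕ} (i : Fin n) : U n := ⟨onQubit i matX, onQubit_mem i matX_mem⟩

/-- The unitary gate `Z` on qubit `i`. -/
def gateZ {n : ℕ} (i : Fin n) : U n := ⟨onQubit i matZ, onQubit_mem i matZ_mem⟩

/-- The Hadamard gate on qubit `i`. -/
def gateH {n : ℕ} (i : Fin n) : U n := ⟨onQubit i matH, onQubit_mem i matH_mem⟩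

/-- The phase gate on qubit `i`. -/
def gateS (ω : EighthRoot) {n : ℕ} (i : Fin n) : U n := ⟨onQubit i (matS ω), onQubit_mem i (matS_mem ω)⟩

/-- The controlled `Z` gate on the qubits `i` and `j`. -/
def gateCZ {n : ℕ} (i j : Fin n) : U n := ⟨matCZ i j, matCZ_mem i j⟩

/-- The scalar matrix `ω² I`. -/
def gateScalar (ω : EighthRoot) (n : ℕ) : U n :=
  ⟨((ω : ℂ) ^ 2) • 1, by
    rw [Matrix.mem_unitaryGroup_iff, star_smul, star_one, smul_mul_smul_comm, one_mul]
    have h := ω.mul_star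
    rw [starRingEnd_apply] at h
    rw [h, one_smul]⟩

/-! ### The Pauli group, the Clifford group and the projective Clifford group -/

/-- The `n`-qubit Pauli group. -/
def Pauli (ω : EighthRoot) (n : ℕ) : Subgroup (U n) :=
  Subgroup.closure (Set.range gateX ∪ Set.range gateZ ∪ {gateScalar ω n})

/-- The `n`-qubit Clifford group: the normalizer of the Pauli group in the unitary group. -/
def Clifford (ω : EighthRoot) (n : ℕ) : Subgroup (U n) :=
  Subgroup.normalizer (Pauli ω n : Set (U n))

/-- The group of global phases: the unitary scalar matrices. -/
def phases (n : ℕ) : Subgroup (U n) where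
  carrier := {A | ∃ c : ℂ, (A : Matrix (Basis n) (Basis n) ℂ) = c • 1}
  one_mem' := ⟨1, by simp⟩
  mul_mem' := by
    rintro A B ⟨a, ha⟩ ⟨b, hb⟩
    exact ⟨a * b, by rw [Submonoid.coe_mul, ha, hb, smul_mul_smul_comm, one_mul]⟩
  inv_mem' := by
    rintro A ⟨a, ha⟩
    exact ⟨star a, by rw [Matrix.UnitaryGroup.inv_val, ha, star_smul, star_one]⟩

instance phases_normal (n : ℕ) : (phases n).Normal where
  conj_mem := by
    rintro A ⟨a, ha⟩ B
    refine ⟨a, ?_⟩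
    have h : B * A * B⁻¹ = A := by
      rw [mul_inv_eq_iff_eq_mul]
      apply Subtype.ext
      rw [Submonoid.coe_mul, Submonoid.coe_mul, ha]
      simp
    rw [h, ha]

/-- The `n`-qubit projective Clifford group: the Clifford group modulo global phases. Products are
written from left to right, as for circuits; this is the opposite of matrix multiplication. -/
abbrev ProjClifford (ω : EighthRoot) (n : ℕ) : Type :=
  (Clifford ω n ⧸ (phases n).subgroupOf (Clifford ω n))ᵐᵒᵖ

/-- The class of a Clifford operator in the projective Clifford group. -/
def toProj {ω : EighthRoot} {n : ℕ} (A : Clifford ω n) : ProjClifford ω n :=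
  MulOpposite.op (QuotientGroup.mk A)

theorem gateX_mem_pauli (ω : EighthRoot) {n : ℕ} (i : Fin n) : gateX i ∈ Pauli ω n :=
  Subgroup.subset_closure (Or.inl (Or.inl ⟨i, rfl⟩))

theorem gateZ_mem_pauli (ω : EighthRoot) {n : ℕ} (i : Fin n) : gateZ i ∈ Pauli ω n :=
  Subgroup.subset_closure (Or.inl (Or.inr ⟨i, rfl⟩))

theorem gateScalar_mem_pauli (ω : EighthRoot) (n : ℕ) : gateScalar ω n ∈ Pauli ω n :=
  Subgroup.subset_closure (Or.inr rfl)

theorem gateScalar_comm (ω : EighthRoot) {n : ℕ} (A : U n) :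
    A * gateScalar ω n = gateScalar ω n * A := by
  apply Subtype.ext
  simp [gateScalar]

/-- A unitary of order dividing four is a Clifford operator if it conjugates the `X` and `Z`
generators into the Pauli group. -/
theorem mem_clifford_of_gen (ω : EighthRoot) {n : ℕ} (A : U n) (h4 : A ^ 4 = 1)
    (hX : ∀ i, ∃ P ∈ Pauli ω n, A * gateX i = P * A)
    (hZ : ∀ i, ∃ P ∈ Pauli ω n, A * gateZ i = P * A) : A ∈ Clifford ω n := by
  have key : ∀ P ∈ Pauli ω n, A * P * A⁻¹ ∈ Pauli ω n := by
    have hle : Pauli ω n ≤ (Pauli ω n).comap (MulAut.conj A).toMonoidHom := by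
      conv_lhs => rw [Pauli]
      rw [Subgroup.closure_le]
      rintro B ((⟨i, rfl⟩ | ⟨i, rfl⟩) | rfl)
      · obtain ⟨P, hP, h⟩ := hX i
        change A * gateX i * A⁻¹ ∈ Pauli ω n
        rwa [h, mul_inv_cancel_right]
      · obtain ⟨P, hP, h⟩ := hZ i
        change A * gateZ i * A⁻¹ ∈ Pauli ω n
        rwa [h, mul_inv_cancel_right]
      · change A * gateScalar ω n * A⁻¹ ∈ Pauli ω n
        rw [gateScalar_comm, mul_inv_cancel_right]
        exact gateScalar_mem_pauli ω n
    exact fun P hP => hle hP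
  rw [Clifford, Subgroup.mem_normalizer_iff]
  intro P
  refine ⟨key P, fun hP => ?_⟩
  have h := key _ (key _ (key _ hP))
  have e : A * (A * (A * (A * P * A⁻¹) * A⁻¹) * A⁻¹) * A⁻¹ = A ^ 4 * P * (A ^ 4)⁻¹ := by
    simp only [pow_succ, pow_zero, one_mul, _root_.mul_inv_rev, mul_assoc]
  rw [e, h4] at h
  simpa using h

theorem gateH_mem (ω : EighthRoot) {n : ℕ} (i : Fin n) : gateH i ∈ Clifford ω n := by
  have e1 : matH * matX = matZ * matH := by
    ext a b
    fin_cases a <;> fin_cases b <;>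
      simp [matH, matX, matZ, Matrix.mul_apply, Fin.sum_univ_two]
  have e2 : matH * matZ = matX * matH := by
    ext a b
    fin_cases a <;> fin_cases b <;>
      simp [matH, matX, matZ, Matrix.mul_apply, Fin.sum_univ_two]
  have h2 : gateH i * gateH i = (1 : U n) := Subtype.ext (by
    change onQubit i matH * onQubit i matH = 1
    rw [onQubit_mul, matH_mul_self, onQubit_one])
  refine mem_clifford_of_gen ω _ ?_ (fun j => ?_) (fun j => ?_)
  · rw [show (4 : ℕ) = 2 * 2 from rfl, pow_mul, pow_two (gateH i), h2, one_pow]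
  · by_cases hij : i = j
    · subst hij
      refine ⟨gateZ i, gateZ_mem_pauli ω i, Subtype.ext ?_⟩
      change onQubit i matH * onQubit i matX = onQubit i matZ * onQubit i matH
      rw [onQubit_mul, onQubit_mul, e1]
    · exact ⟨gateX j, gateX_mem_pauli ω j, Subtype.ext (onQubit_comm hij _ _)⟩
  · by_cases hij : i = j
    · subst hij
      refine ⟨gateX i, gateX_mem_pauli ω i, Subtype.ext ?_⟩
      change onQubit i matH * onQubit i matZ = onQubit i matX * onQubit i matH
      rw [onQubit_mul, onQubit_mul, e2]
    · exact ⟨gateZ j, gateZ_mem_pauli ω j, Subtype.ext (onQubit_comm hij _ _)⟩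

theorem gateS_mem (ω : EighthRoot) {n : ℕ} (i : Fin n) : gateS ω i ∈ Clifford ω n := by
  have hω := ω.pow_four
  have e1 : matS ω * matX = (((ω : ℂ) ^ 2) • (matX * matZ)) * matS ω := by
    ext a b
    fin_cases a <;> fin_cases b <;>
      simp [matS, matX, matZ, Matrix.mul_apply, Fin.sum_univ_two]
    linear_combination hω
  have e2 : matS ω * matZ = matZ * matS ω := by
    ext a b
    fin_cases a <;> fin_cases b <;>
      simp [matS, matZ, Matrix.mul_apply, Fin.sum_univ_two]
  have e4 : (matS ω * matS ω) * (matS ω * matS ω) = 1 := by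
    ext a b
    fin_cases a <;> fin_cases b <;>
      simp [matS, Matrix.mul_apply, Fin.sum_univ_two]
    linear_combination ((ω : ℂ) ^ 4 - 1) * hω
  refine mem_clifford_of_gen ω _ ?_ (fun j => ?_) (fun j => ?_)
  · have h : gateS ω i ^ 4 = (gateS ω i * gateS ω i) * (gateS ω i * gateS ω i) := by
      rw [show (4 : ℕ) = 2 * 2 from rfl, pow_mul, pow_two, pow_two]
    rw [h]
    refine Subtype.ext ?_
    change (onQubit i (matS ω) * onQubit i (matS ω)) * (onQubit i (matS ω) * onQubit i (matS ω)) = 1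
    rw [onQubit_mul, onQubit_mul, e4, onQubit_one]
  · by_cases hij : i = j
    · subst hij
      refine ⟨gateScalar ω n * (gateX i * gateZ i), mul_mem (gateScalar_mem_pauli ω n)
        (mul_mem (gateX_mem_pauli ω i) (gateZ_mem_pauli ω i)), Subtype.ext ?_⟩
      change onQubit i (matS ω) * onQubit i matX =
        (((ω : ℂ) ^ 2) • 1 * (onQubit i matX * onQubit i matZ)) * onQubit i (matS ω)
      rw [onQubit_mul, onQubit_mul, smul_mul_assoc, one_mul, ← onQubit_smul, onQubit_mul, e1]
    · exact ⟨gateX j, gateX_mem_pauli ω j, Subtype.ext (onQubit_comm hij _ _)⟩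
  · by_cases hij : i = j
    · subst hij
      refine ⟨gateZ i, gateZ_mem_pauli ω i, Subtype.ext ?_⟩
      change onQubit i (matS ω) * onQubit i matZ = onQubit i matZ * onQubit i (matS ω)
      rw [onQubit_mul, onQubit_mul, e2]
    · exact ⟨gateZ j, gateZ_mem_pauli ω j, Subtype.ext (onQubit_comm hij _ _)⟩

theorem matCZ_comm {n : ℕ} (i j : Fin n) : matCZ i j = matCZ j i := by
  simp only [matCZ, and_comm]

theorem onQubit_matZ {n : ℕ} (i : Fin n) :
    onQubit i matZ = Matrix.diagonal fun x : Basis n => if x i = 1 then (-1 : ℂ) else 1 := by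
  ext x y
  rw [onQubit_apply, Matrix.diagonal_apply]
  by_cases hxy : x = y
  · subst hxy
    have : ∀ a : Fin 2, matZ a a = if a = 1 then (-1 : ℂ) else 1 := by
      intro a
      fin_cases a <;> simp [matZ]
    simp [this]
  · rw [if_neg hxy]
    split_ifs with h
    · have hne : x i ≠ y i := fun hi => hxy (funext fun k => by
        by_cases hk : k = i
        · exact hk ▸ hi
        · exact h k hk)
      have : ∀ a b : Fin 2, a ≠ b → matZ a b = 0 := by
        intro a b
        fin_cases a <;> fin_cases b <;> simp [matZ]
      exact this _ _ hne
    · rfl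

theorem matCZ_matX {n : ℕ} {i j : Fin n} (hij : i ≠ j) :
    matCZ i j * onQubit i matX = onQubit i matX * onQubit j matZ * matCZ i j := by
  ext x y
  rw [onQubit_matZ, matCZ, Matrix.diagonal_mul, Matrix.mul_diagonal, Matrix.mul_diagonal,
    onQubit_apply]
  by_cases hk : ∀ k, k ≠ i → x k = y k
  · rw [if_pos hk, hk j hij.symm]
    have key : ∀ a b c : Fin 2, (if a = 1 ∧ c = 1 then (-1 : ℂ) else 1) * matX a b =
        matX a b * (if c = 1 then (-1 : ℂ) else 1) * (if b = 1 ∧ c = 1 then (-1 : ℂ) else 1) := by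
      intro a b c
      fin_cases a <;> fin_cases b <;> fin_cases c <;> simp [matX]
    exact key _ _ _
  · simp [if_neg hk]

theorem gateCZ_mem (ω : EighthRoot) {n : ℕ} {i j : Fin n} (hij : i ≠ j) :
    gateCZ i j ∈ Clifford ω n := by
  have h2 : gateCZ i j * gateCZ i j = (1 : U n) := Subtype.ext (matCZ_mul_self i j)
  refine mem_clifford_of_gen ω _ ?_ (fun k => ?_) (fun k => ?_)
  · rw [show (4 : ℕ) = 2 * 2 from rfl, pow_mul, pow_two (gateCZ i j), h2, one_pow]
  · by_cases hi : k = i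
    · subst hi
      exact ⟨gateX k * gateZ j, mul_mem (gateX_mem_pauli ω k) (gateZ_mem_pauli ω j),
        Subtype.ext (matCZ_matX hij)⟩
    · by_cases hj : k = j
      · subst hj
        refine ⟨gateX k * gateZ i, mul_mem (gateX_mem_pauli ω k) (gateZ_mem_pauli ω i),
          Subtype.ext ?_⟩
        change matCZ i k * onQubit k matX = onQubit k matX * onQubit i matZ * matCZ i k
        rw [matCZ_comm i k]
        exact matCZ_matX hi
      · refine ⟨gateX k, gateX_mem_pauli ω k, Subtype.ext ?_⟩
        change matCZ i j * onQubit k matX = onQubit k matX * matCZ i j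
        ext x y
        rw [matCZ, Matrix.diagonal_mul, Matrix.mul_diagonal, onQubit_apply]
        by_cases hk : ∀ l, l ≠ k → x l = y l
        · rw [if_pos hk, hk i (Ne.symm hi), hk j (Ne.symm hj), mul_comm]
        · simp [if_neg hk]
  · refine ⟨gateZ k, gateZ_mem_pauli ω k, Subtype.ext ?_⟩
    change matCZ i j * onQubit k matZ = onQubit k matZ * matCZ i j
    rw [onQubit_matZ, matCZ, Matrix.diagonal_mul_diagonal, Matrix.diagonal_mul_diagonal]
    congr 1
    funext x
    exact mul_comm _ _

/-! ### The generators and the subgroups -/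

/-- The class of the Hadamard gate on qubit `i`. -/
def h (ω : EighthRoot) {n : ℕ} (i : Fin n) : ProjClifford ω n := toProj ⟨gateH i, gateH_mem ω i⟩

/-- The class of the phase gate on qubit `i`. -/
def s (ω : EighthRoot) {n : ℕ} (i : Fin n) : ProjClifford ω n :=
  toProj ⟨gateS ω i, gateS_mem ω i⟩

/-- The class of the controlled `Z` gate on the adjacent qubits `i` and `i + 1`. -/
def lam (ω : EighthRoot) {n : ℕ} (i : Fin n) (hi : (i : ℕ) + 1 < n) : ProjClifford ω n :=
  toProj ⟨gateCZ i ⟨i + 1, hi⟩, gateCZ_mem ω (Fin.ne_of_val_ne (Nat.succ_ne_self _).symm)⟩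

/-- The element `h₂ Λ₁ s₂² h₂ h₁ s₁² h₂ Λ₁ h₂`, with the usual numbering of the qubits. -/
def M (ω : EighthRoot) (n : ℕ) : ProjClifford ω (n + 2) :=
  h ω 1 * lam ω 0 (by simp) * s ω 1 ^ 2 * h ω 1 * h ω 0 * s ω 0 ^ 2 * h ω 1 * lam ω 0 (by simp) *
    h ω 1

/-- The gates `h_i`, `s_i` and `Λ_i` for all qubits `i` except the first one. -/
def tailGates (ω : EighthRoot) (n : ℕ) : Set (ProjClifford ω n) :=
  {g | ∃ i : Fin n, (i : ℕ) ≠ 0 ∧ (g = h ω i ∨ g = s ω i ∨ ∃ hi, g = lam ω i hi)}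

/-- The inertia subgroup, given by generators. -/
def IN (ω : EighthRoot) : (n : ℕ) → Subgroup (ProjClifford ω n)
  | 0 => ⊥
  | 1 => Subgroup.closure {h ω 0, s ω 0 ^ 3 * h ω 0 * s ω 0 * h ω 0 * s ω 0}
  | 2 => Subgroup.closure {h ω 0, h ω 1, s ω 1, h ω 0 * s ω 0 ^ 2 * h ω 0, M ω 0}
  | n + 3 => Subgroup.closure ({h ω 0, M ω (n + 1)} ∪ tailGates ω (n + 3))

/-- The subgroup `F` of the inertia subgroup, given by generators. -/
def F (ω : EighthRoot) : (n : ℕ) → Subgroup (ProjClifford ω n)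
  | 0 => ⊥
  | 1 => Subgroup.closure {s ω 0 ^ 3 * h ω 0 * s ω 0 * h ω 0 * s ω 0}
  | 2 => Subgroup.closure {h ω 1, s ω 1, s ω 0 ^ 3 * h ω 0 * s ω 0 * h ω 0 * s ω 0, M ω 0}
  | n + 3 => Subgroup.closure ({M ω (n + 1)} ∪ tailGates ω (n + 3))

end

end QubitClifford

/-!
Conjugation by a Clifford operator permutes the Pauli operators up to sign and preserves the
symplectic form on their labels; the operators that commute with all Pauli operators are the
scalars. The square root of the Pauli operator labelled `v` acts on the labels as the transvection
along `v`. Composing a Clifford operator that commutes with `Z₁` with such square roots, for labels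
orthogonal to that of `Z₁`, one qubit at a time, one can make it commute with all Pauli operators.
Hence the centralizer of `s₁` is generated by these square roots, and since the labels whose square
roots lie in a given subgroup are closed under transvections, few gates produce all of them.

The element `s₁³h₁s₁h₁s₁` is a square root of the Pauli operator `Y₁`. Conjugation by `h₁s₁` takes
it to `s₁`, and takes `M` to the inverse of the square root of `Z₁X₂`, up to a Pauli operator on the
second qubit. Therefore `F` is the centralizer of `s₁³h₁s₁h₁s₁`. The involution `h₁` inverts this
element, which is not an involution, so `F` has index two in `⟨F, h₁⟩`, which is the inertia
subgroup.
-/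

namespace QubitClifford

noncomputable section

/-! ### Labels of Pauli operators and the symplectic form -/

/-- Labels of the `n`-qubit Pauli operators up to scalars: the pair of bits `(a, b)` in position `k`
stands for the factor `X ^ a * Z ^ b` on qubit `k`. -/
abbrev Label (n : ℕ) : Type := Fin n → ZMod 2 × ZMod 2

/-- The label of the Pauli operator `X` on qubit `i`. -/
abbrev xLabel {n : ℕ} (i : Fin n) : Label n := Pi.single i (1, 0)

/-- The label of the Pauli operator `Y` on qubit `i`. -/
abbrev yLabel {n : ℕ} (i : Fin n) : Label n := Pi.single i (1, 1)

/-- The label of the Pauli operator `Z` on qubit `i`. -/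
abbrev zLabel {n : ℕ} (i : Fin n) : Label n := Pi.single i (0, 1)

/-- The symplectic form on the labels of one-qubit Pauli operators. -/
def qubitForm (a b : ZMod 2 × ZMod 2) : ZMod 2 := a.1 * b.2 + a.2 * b.1

/-- The symplectic form on labels. It detects commutation: see `commute_pauliOp_iff`. -/
def sympForm {n : ℕ} (v w : Label n) : ZMod 2 := ∑ k, qubitForm (v k) (w k)

theorem eq_zero_or_eq_one (a : ZMod 2) : a = 0 ∨ a = 1 := by
  revert a; decide

theorem qubitForm_comm (a b : ZMod 2 × ZMod 2) : qubitForm a b = qubitForm b a := by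
  rw [qubitForm, qubitForm, add_comm, mul_comm a.2, mul_comm a.1]

theorem qubitForm_self (a : ZMod 2 × ZMod 2) : qubitForm a a = 0 := by
  rw [qubitForm, mul_comm, CharTwo.add_self_eq_zero]

theorem exists_qubitForm_eq_one {a : ZMod 2 × ZMod 2} (ha : a ≠ 0) : ∃ b, qubitForm a b = 1 := by
  revert a; decide

theorem bits_eq_smul_add_smul (a : ZMod 2 × ZMod 2) : a = a.1 • (1, 0) + a.2 • (0, 1) := by
  simp

section

variable {n : ℕ}

theorem label_induction {p : Label n → Prop} (zero : p 0) (add : ∀ v w, p v → p w → p (v + w))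
    (x : ∀ i, p (xLabel i)) (z : ∀ i, p (zLabel i)) (v : Label n) : p v := by
  have smul : ∀ (c : ZMod 2) (w : Label n), p w → p (c • w) := fun c w hw => by
    rcases eq_zero_or_eq_one c with rfl | rfl
    · rwa [zero_smul]
    · rwa [one_smul]
  rw [← Finset.univ_sum_single v]
  refine Finset.sum_induction _ p add zero fun i _ => ?_
  rw [bits_eq_smul_add_smul (v i), Pi.single_add, Pi.single_smul', Pi.single_smul']
  exact add _ _ (smul _ _ (x i)) (smul _ _ (z i))

theorem sympForm_comm (v w : Label n) : sympForm v w = sympForm w v := by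
  simp only [sympForm, qubitForm_comm]

theorem sympForm_self (v : Label n) : sympForm v v = 0 := by
  simp only [sympForm, qubitForm_self, Finset.sum_const_zero]

theorem sympForm_add_left (u v w : Label n) :
    sympForm (u + v) w = sympForm u w + sympForm v w := by
  simp only [sympForm, qubitForm, Pi.add_apply, Prod.fst_add, Prod.snd_add,
    ← Finset.sum_add_distrib]
  exact Finset.sum_congr rfl fun k _ => by ring

theorem sympForm_add_right (u v w : Label n) :
    sympForm u (v + w) = sympForm u v + sympForm u w := by
  rw [sympForm_comm, sympForm_add_left, sympForm_comm v, sympForm_comm w]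

theorem sympForm_single (v : Label n) (i : Fin n) (a : ZMod 2 × ZMod 2) :
    sympForm v (Pi.single i a) = qubitForm (v i) a := by
  rw [sympForm, Finset.sum_eq_single_of_mem i (Finset.mem_univ i), Pi.single_eq_same]
  intro k _ hk
  simp [Pi.single_eq_of_ne hk, qubitForm]

theorem sympForm_single_left (i : Fin n) (a : ZMod 2 × ZMod 2) (v : Label n) :
    sympForm (Pi.single i a) v = qubitForm a (v i) := by
  rw [sympForm_comm, sympForm_single, qubitForm_comm]

theorem sympForm_xLabel_zLabel (i : Fin n) : sympForm (xLabel i) (zLabel i) = 1 := by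
  rw [sympForm_single_left, zLabel, Pi.single_eq_same]; rfl

theorem sympForm_zLabel_xLabel (i : Fin n) : sympForm (zLabel i) (xLabel i) = 1 := by
  rw [sympForm_comm, sympForm_xLabel_zLabel]

theorem zLabel_ne_zero (i : Fin n) : zLabel i ≠ 0 := by
  rw [Ne, Pi.single_eq_zero_iff]; decide

theorem add_add_cancel_label (v w : Label n) : v + (v + w) = w := by
  rw [← add_assoc, ZModModule.add_self, zero_add]

end

/-- The labels that vanish on the first `k` qubits. -/
def supportedFrom (n k : ℕ) : AddSubgroup (Label n) where
  carrier := {v | ∀ i : Fin n, (i : ℕ) < k → v i = 0}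
  zero_mem' _ _ := rfl
  add_mem' hv hw i hi := by rw [Pi.add_apply, hv i hi, hw i hi, add_zero]
  neg_mem' hv i hi := by rw [Pi.neg_apply, hv i hi, neg_zero]

section

variable {n k : ℕ} {u v : Label n}

theorem supportedFrom_anti {l : ℕ} (hlk : l ≤ k) : supportedFrom n k ≤ supportedFrom n l :=
  fun _ hv i hi => hv i (hi.trans_le hlk)

theorem single_mem_supportedFrom {i : Fin n} (hi : k ≤ i) (a : ZMod 2 × ZMod 2) :
    Pi.single i a ∈ supportedFrom n k := fun _ hj =>
  Pi.single_eq_of_ne (M := fun _ => ZMod 2 × ZMod 2) (Fin.ne_of_lt (hj.trans_le hi)) a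

theorem exists_sympForm_eq_one (hv : v ∈ supportedFrom n k) (hv₀ : v ≠ 0) :
    ∃ w ∈ supportedFrom n k, sympForm v w = 1 := by
  obtain ⟨i, hi⟩ := Function.ne_iff.mp hv₀
  obtain ⟨b, hb⟩ := exists_qubitForm_eq_one hi
  have hki : k ≤ i := not_lt.mp fun hlt => hi (hv i hlt)
  exact ⟨Pi.single i b, single_mem_supportedFrom hki b, by rw [sympForm_single, hb]⟩

theorem exists_sympForm_eq_one_pair (hu : u ∈ supportedFrom n k) (hu₀ : u ≠ 0)
    (hv : v ∈ supportedFrom n k) (hv₀ : v ≠ 0) :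
    ∃ w ∈ supportedFrom n k, sympForm u w = 1 ∧ sympForm v w = 1 := by
  obtain ⟨a, ha, hua⟩ := exists_sympForm_eq_one hu hu₀
  obtain ⟨b, hb, hvb⟩ := exists_sympForm_eq_one hv hv₀
  rcases eq_zero_or_eq_one (sympForm v a) with hva | hva
  · rcases eq_zero_or_eq_one (sympForm u b) with hub | hub
    · exact ⟨a + b, add_mem ha hb, by rw [sympForm_add_right, hua, hub, add_zero],
        by rw [sympForm_add_right, hva, hvb, zero_add]⟩
    · exact ⟨b, hb, hub, hvb⟩
  · exact ⟨a, ha, hua, hva⟩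

end

/-! ### Hermitian Pauli operators -/

/-- The character `a ↦ (-1) ^ a` of `ZMod 2`. -/
def signChar : AddChar (ZMod 2) ℂ := AddChar.zmodChar 2 (neg_one_sq (R := ℂ))

theorem signChar_mul_self (a : ZMod 2) : signChar a * signChar a = 1 := by
  rw [← AddChar.map_add_eq_mul, CharTwo.add_self_eq_zero, AddChar.map_zero_eq_one]

theorem signChar_one : signChar 1 = -1 := by
  rw [signChar, AddChar.zmodChar_apply, ZMod.val_one, pow_one]

theorem signChar_sum {ι : Type*} (t : Finset ι) (f : ι → ZMod 2) :
    signChar (∑ k ∈ t, f k) = ∏ k ∈ t, signChar (f k) :=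
  map_prod signChar.toMonoidHom (fun k => Multiplicative.ofAdd (f k)) t

theorem EighthRoot.sq_mul_sq (ω : EighthRoot) : (ω : ℂ) ^ 2 * (ω : ℂ) ^ 2 = -1 := by
  rw [← pow_add]
  exact ω.pow_four

theorem EighthRoot.sq_ne_zero (ω : EighthRoot) : (ω : ℂ) ^ 2 ≠ 0 :=
  left_ne_zero_of_mul_eq_one ω.mul_star

theorem EighthRoot.star_sq (ω : EighthRoot) : star ((ω : ℂ) ^ 2) = -(ω : ℂ) ^ 2 := by
  refine mul_left_cancel₀ ω.sq_ne_zero ?_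
  rw [mul_neg, ω.sq_mul_sq, neg_neg]
  exact ω.mul_star

theorem matX_mul_self : matX * matX = 1 := by
  simp [matX, Matrix.one_fin_two]

theorem matZ_mul_self : matZ * matZ = 1 := by
  simp [matZ, Matrix.one_fin_two]

theorem matZ_mul_matX : matZ * matX = -(matX * matZ) := by
  simp [matX, matZ]

theorem star_matX : star matX = matX := by
  ext i j; fin_cases i <;> fin_cases j <;> simp [matX]

theorem star_matZ : star matZ = matZ := by
  ext i j; fin_cases i <;> fin_cases j <;> simp [matZ]

theorem pow_val_add_of_mul_self_eq_one {G : Type*} [Monoid G] {x : G} (hx : x * x = 1)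
    (a b : ZMod 2) : x ^ (a + b).val = x ^ a.val * x ^ b.val := by
  rw [ZMod.val_add, ← pow_eq_pow_mod _ (by rwa [pow_two]), pow_add]

/-- The matrix `X ^ a * Z ^ b` for a pair of bits `(a, b)`. -/
def weylMat (a : ZMod 2 × ZMod 2) : Matrix (Fin 2) (Fin 2) ℂ := matX ^ a.1.val * matZ ^ a.2.val

theorem matZ_pow_mul_matX_pow (a b : ZMod 2) :
    matZ ^ a.val * matX ^ b.val = signChar (a * b) • (matX ^ b.val * matZ ^ a.val) := by
  rcases eq_zero_or_eq_one a with rfl | rfl <;> rcases eq_zero_or_eq_one b with rfl | rfl <;>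
    simp [signChar_one, matZ_mul_matX, ZMod.val_one]

theorem weylMat_mul (a b : ZMod 2 × ZMod 2) :
    weylMat a * weylMat b = signChar (a.2 * b.1) • weylMat (a + b) := by
  calc weylMat a * weylMat b
      = matX ^ a.1.val * (matZ ^ a.2.val * matX ^ b.1.val) * matZ ^ b.2.val := by
        simp only [weylMat, mul_assoc]
    _ = signChar (a.2 * b.1) •
          ((matX ^ a.1.val * matX ^ b.1.val) * (matZ ^ a.2.val * matZ ^ b.2.val)) := by
        simp only [matZ_pow_mul_matX_pow, mul_smul_comm, smul_mul_assoc, mul_assoc]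
    _ = signChar (a.2 * b.1) • weylMat (a + b) := by
        rw [weylMat, Prod.fst_add, Prod.snd_add, pow_val_add_of_mul_self_eq_one matX_mul_self,
          pow_val_add_of_mul_self_eq_one matZ_mul_self]

theorem weylMat_zero : weylMat 0 = 1 := by
  simp [weylMat]

theorem star_weylMat (a : ZMod 2 × ZMod 2) :
    star (weylMat a) = signChar (a.1 * a.2) • weylMat a := by
  rw [weylMat, star_mul, star_pow, star_pow, star_matX, star_matZ, matZ_pow_mul_matX_pow,
    mul_comm a.2]

/-- The scalar that makes `weylMat a` hermitian: `ω ^ 2` if `a = (1, 1)`, and `1` otherwise. -/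
def pauliScalar (ω : EighthRoot) (a : ZMod 2 × ZMod 2) : ℂ :=
  ((ω : ℂ) ^ 2) ^ (a.1 * a.2).val

theorem pauliScalar_ne_zero (ω : EighthRoot) (a : ZMod 2 × ZMod 2) : pauliScalar ω a ≠ 0 :=
  pow_ne_zero _ ω.sq_ne_zero

theorem pauliScalar_mul_self (ω : EighthRoot) (a : ZMod 2 × ZMod 2) :
    pauliScalar ω a * pauliScalar ω a = signChar (a.1 * a.2) := by
  rw [pauliScalar, ← mul_pow, ω.sq_mul_sq, signChar, AddChar.zmodChar_apply]

theorem pauliScalar_pow_four (ω : EighthRoot) (a : ZMod 2 × ZMod 2) : pauliScalar ω a ^ 4 = 1 := by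
  rw [pow_mul _ 2 2, pow_two (pauliScalar ω a), pauliScalar_mul_self, pow_two, signChar_mul_self]

theorem star_pauliScalar (ω : EighthRoot) (a : ZMod 2 × ZMod 2) :
    star (pauliScalar ω a) = signChar (a.1 * a.2) * pauliScalar ω a := by
  rw [pauliScalar, star_pow, ω.star_sq, neg_pow, signChar, AddChar.zmodChar_apply]

/-- The hermitian one-qubit Pauli matrix with label `a`, that is `1`, `X`, `Z` or `Y = i X Z` with
`i = ω ^ 2`. -/
def pauliMat (ω : EighthRoot) (a : ZMod 2 × ZMod 2) : Matrix (Fin 2) (Fin 2) ℂ :=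
  pauliScalar ω a • weylMat a

theorem pauliMat_zero (ω : EighthRoot) : pauliMat ω 0 = 1 := by
  simp [pauliMat, pauliScalar, weylMat_zero]

theorem pauliMat_x (ω : EighthRoot) : pauliMat ω (1, 0) = matX := by
  simp [pauliMat, pauliScalar, weylMat, ZMod.val_one]

theorem pauliMat_z (ω : EighthRoot) : pauliMat ω (0, 1) = matZ := by
  simp [pauliMat, pauliScalar, weylMat, ZMod.val_one]

theorem pauliMat_mul (ω : EighthRoot) (a b : ZMod 2 × ZMod 2) :
    ∃ c : ℂ, c ^ 4 = 1 ∧ pauliMat ω a * pauliMat ω b = c • pauliMat ω (a + b) := by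
  have hsign : signChar (a.2 * b.1) ^ 4 = 1 := by
    rw [pow_mul _ 2 2, pow_two (signChar _), signChar_mul_self, one_pow]
  refine ⟨pauliScalar ω a * pauliScalar ω b * signChar (a.2 * b.1) / pauliScalar ω (a + b), ?_, ?_⟩
  · simp only [div_pow, mul_pow, pauliScalar_pow_four, hsign, mul_one, div_one]
  rw [pauliMat, pauliMat, pauliMat, smul_mul_smul_comm, weylMat_mul, smul_smul, smul_smul,
    div_mul_cancel₀ _ (pauliScalar_ne_zero ω _)]

theorem pauliMat_mul_comm (ω : EighthRoot) (a b : ZMod 2 × ZMod 2) :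
    pauliMat ω a * pauliMat ω b = signChar (qubitForm a b) • (pauliMat ω b * pauliMat ω a) := by
  have hsign : signChar (qubitForm a b) * signChar (b.2 * a.1) = signChar (a.2 * b.1) := by
    rw [← AddChar.map_add_eq_mul, qubitForm, mul_comm b.2,
      add_right_comm, CharTwo.add_self_eq_zero, zero_add]
  rw [pauliMat, pauliMat, smul_mul_smul_comm, smul_mul_smul_comm, weylMat_mul, weylMat_mul,
    add_comm b a, smul_comm (signChar (qubitForm a b)), smul_smul (signChar (qubitForm a b)), hsign,
    mul_comm (pauliScalar ω b)]

theorem pauliMat_mul_self (ω : EighthRoot) (a : ZMod 2 × ZMod 2) :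
    pauliMat ω a * pauliMat ω a = 1 := by
  rw [pauliMat, smul_mul_smul_comm, pauliScalar_mul_self, weylMat_mul, smul_smul, mul_comm a.2,
    signChar_mul_self, one_smul, ZModModule.add_self, weylMat_zero]

theorem star_pauliMat (ω : EighthRoot) (a : ZMod 2 × ZMod 2) :
    star (pauliMat ω a) = pauliMat ω a := by
  rw [pauliMat, star_smul, star_pauliScalar, star_weylMat, smul_smul, mul_right_comm,
    signChar_mul_self, one_mul]

theorem tensorMat_smul {n : ℕ} (c : Fin n → ℂ) (f : Fin n → Matrix (Fin 2) (Fin 2) ℂ) :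
    tensorMat (fun k => c k • f k) = (∏ k, c k) • tensorMat f := by
  ext x y
  simp only [tensorMat, Matrix.of_apply, Matrix.smul_apply, smul_eq_mul, Finset.prod_mul_distrib]

/-- The hermitian Pauli operator with label `v`. -/
def pauliOp (ω : EighthRoot) {n : ℕ} (v : Label n) : U n :=
  ⟨tensorMat fun k => pauliMat ω (v k), by
    simp only [Matrix.mem_unitaryGroup_iff, tensorMat_star, tensorMat_mul, star_pauliMat,
      pauliMat_mul_self, tensorMat_one]⟩

section

variable {ω : EighthRoot} {n : ℕ}

theorem coe_pauliOp (v : Label n) :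
    (pauliOp ω v : Matrix (Basis n) (Basis n) ℂ) = tensorMat fun k => pauliMat ω (v k) := rfl

theorem pauliOp_zero : pauliOp ω (0 : Label n) = 1 := by
  apply Subtype.ext
  simp only [coe_pauliOp, Pi.zero_apply, pauliMat_zero, tensorMat_one, OneMemClass.coe_one]

theorem coe_pauliOp_mul_self (v : Label n) : (pauliOp ω v).1 * (pauliOp ω v).1 = 1 := by
  simp only [coe_pauliOp, tensorMat_mul, pauliMat_mul_self, tensorMat_one]

theorem pauliOp_mul_self (v : Label n) : pauliOp ω v * pauliOp ω v = 1 :=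
  Subtype.ext (coe_pauliOp_mul_self v)

theorem inv_pauliOp (v : Label n) : (pauliOp ω v)⁻¹ = pauliOp ω v :=
  inv_eq_of_mul_eq_one_left (pauliOp_mul_self v)

theorem star_coe_pauliOp (v : Label n) : star (pauliOp ω v).1 = (pauliOp ω v).1 := by
  rw [← Matrix.UnitaryGroup.inv_val, inv_pauliOp]

theorem pauliOp_mul (v w : Label n) :
    ∃ c : ℂ, c ^ 4 = 1 ∧ (pauliOp ω v).1 * (pauliOp ω w).1 = c • (pauliOp ω (v + w)).1 := by
  choose c hc h using fun k => pauliMat_mul ω (v k) (w k)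
  refine ⟨∏ k, c k, by simp only [← Finset.prod_pow, hc, Finset.prod_const_one], ?_⟩
  simp only [coe_pauliOp, tensorMat_mul, h, tensorMat_smul, Pi.add_apply]

theorem coe_pauliOp_mul_comm (v w : Label n) :
    (pauliOp ω v).1 * (pauliOp ω w).1 =
      signChar (sympForm v w) • ((pauliOp ω w).1 * (pauliOp ω v).1) := by
  simp only [coe_pauliOp, tensorMat_mul, sympForm, signChar_sum, ← tensorMat_smul,
    ← pauliMat_mul_comm]

theorem onQubit_pauliMat (i : Fin n) (a : ZMod 2 × ZMod 2) :
    onQubit i (pauliMat ω a) = (pauliOp ω (Pi.single i a)).1 := by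
  rw [coe_pauliOp, onQubit]
  congr 1
  funext k
  rw [Pi.single, Function.apply_update (fun _ => pauliMat ω)]
  simp only [Pi.zero_apply, pauliMat_zero]

theorem gateX_eq_pauliOp (i : Fin n) : gateX i = pauliOp ω (xLabel i) :=
  Subtype.ext (by rw [← onQubit_pauliMat, pauliMat_x]; rfl)

theorem gateZ_eq_pauliOp (i : Fin n) : gateZ i = pauliOp ω (zLabel i) :=
  Subtype.ext (by rw [← onQubit_pauliMat, pauliMat_z]; rfl)

theorem commute_pauliOp {v w : Label n} (hvw : sympForm v w = 0) :
    Commute (pauliOp ω v) (pauliOp ω w) :=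
  Subtype.ext (by
    rw [Submonoid.coe_mul, Submonoid.coe_mul, coe_pauliOp_mul_comm, hvw,
      AddChar.map_zero_eq_one, one_smul])

theorem pauliOp_anticomm {v w : Label n} (hvw : sympForm v w = 1) :
    (pauliOp ω v).1 * (pauliOp ω w).1 = -((pauliOp ω w).1 * (pauliOp ω v).1) := by
  rw [coe_pauliOp_mul_comm, hvw, signChar_one, neg_smul, one_smul]

theorem coe_unitary_ne_zero (A : U n) : A.1 ≠ 0 :=
  left_ne_zero_of_mul_eq_one (Unitary.coe_mul_star_self A)

theorem commute_pauliOp_iff {v w : Label n} :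
    Commute (pauliOp ω v) (pauliOp ω w) ↔ sympForm v w = 0 := by
  refine ⟨fun hcomm => (eq_zero_or_eq_one _).resolve_right fun hvw => ?_, commute_pauliOp⟩
  have hneg := pauliOp_anticomm (ω := ω) hvw
  rw [← Submonoid.coe_mul, ← Submonoid.coe_mul, hcomm.eq, eq_neg_iff_add_eq_zero,
    ← two_smul ℂ] at hneg
  exact smul_ne_zero two_ne_zero (coe_unitary_ne_zero _) hneg

end

/-! ### Square roots of involutions -/

/-- The square root `(1 + i) / 2 + (1 - i) / 2 * p` of an involution `p`, where `i = ω ^ 2`: it acts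
as `1` where `p = 1` and as `i` where `p = -1`. -/
def involutionSqrt {A : Type*} [Ring A] [Algebra ℂ A] (ω : EighthRoot) (p : A) : A :=
  ((1 + (ω : ℂ) ^ 2) / 2) • 1 + ((1 - (ω : ℂ) ^ 2) / 2) • p

section

variable {A : Type*} [Ring A] [Algebra ℂ A] (ω : EighthRoot) {p q : A}

theorem involutionSqrt_mul_self (hp : p * p = 1) :
    involutionSqrt ω p * involutionSqrt ω p = p := by
  simp only [involutionSqrt, add_mul, mul_add, smul_mul_smul_comm, mul_one, one_mul, hp]
  match_scalars
  · linear_combination (1 / 2 : ℂ) * ω.sq_mul_sq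
  · linear_combination (-1 / 2 : ℂ) * ω.sq_mul_sq

theorem involutionSqrt_mul_involutionSqrt_neg (hp : p * p = 1) :
    involutionSqrt ω p * involutionSqrt ω (-p) = ((ω : ℂ) ^ 2) • 1 := by
  simp only [involutionSqrt, add_mul, mul_add, smul_mul_smul_comm, mul_one, one_mul, mul_neg, hp]
  match_scalars <;> ring

theorem involutionSqrt_mul_of_anticomm (hp : p * p = 1) (hpq : p * q = -(q * p)) :
    involutionSqrt ω p * q = (-(ω : ℂ) ^ 2) • (p * q * involutionSqrt ω p) := by
  have hpqp : p * q * p = -q := by rw [hpq, neg_mul, mul_assoc, hp, mul_one]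
  simp only [involutionSqrt, add_mul, mul_add, smul_mul_assoc, mul_one, one_mul, mul_smul_comm,
    hpqp]
  match_scalars <;> linear_combination (1 / 2 : ℂ) * ω.sq_mul_sq

theorem mul_involutionSqrt_mul {a b : A} (hab : a * b = 1) :
    a * involutionSqrt ω p * b = involutionSqrt ω (a * p * b) := by
  simp only [involutionSqrt, mul_add, add_mul, mul_smul_comm, smul_mul_assoc, mul_one, hab]

theorem commute_involutionSqrt_left (hpq : Commute p q) : Commute (involutionSqrt ω p) q :=
  ((Commute.one_left q).smul_left _).add_left (hpq.smul_left _)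

theorem star_involutionSqrt [StarRing A] [StarModule ℂ A] (p : A) :
    star (involutionSqrt ω p) = (-(ω : ℂ) ^ 2) • involutionSqrt ω (-star p) := by
  have htwo : star (2 : ℂ) = 2 := Complex.conj_ofNat 2
  simp only [involutionSqrt, star_add, star_sub, star_smul, star_div₀, star_one, ω.star_sq, htwo,
    smul_add, smul_smul]
  match_scalars
  · linear_combination (1 / 2 : ℂ) * ω.sq_mul_sq
  · linear_combination (1 / 2 : ℂ) * ω.sq_mul_sq

theorem involutionSqrt_mul_star [StarRing A] [StarModule ℂ A] (hp : p * p = 1)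
    (hstar : star p = p) : involutionSqrt ω p * star (involutionSqrt ω p) = 1 := by
  rw [star_involutionSqrt, hstar, mul_smul_comm, involutionSqrt_mul_involutionSqrt_neg ω hp,
    smul_smul, neg_mul, ω.sq_mul_sq, neg_neg, one_smul]

end

/-- The square root of the hermitian Pauli operator with label `v`. Conjugation by it acts on
Pauli operators, up to sign, as the symplectic transvection by `v`. -/
def sqrtPauli (ω : EighthRoot) {n : ℕ} (v : Label n) : U n :=
  ⟨involutionSqrt ω (pauliOp ω v).1, by
    rw [Matrix.mem_unitaryGroup_iff]
    exact involutionSqrt_mul_star ω (coe_pauliOp_mul_self v) (star_coe_pauliOp v)⟩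

section

variable {ω : EighthRoot} {n : ℕ} {A B : U n} {u v w v' w' : Label n}

theorem coe_sqrtPauli (v : Label n) :
    (sqrtPauli ω v).1 = involutionSqrt ω (pauliOp ω v).1 := rfl

theorem sqrtPauli_zero : sqrtPauli ω (0 : Label n) = 1 := by
  refine Subtype.ext ?_
  rw [coe_sqrtPauli, pauliOp_zero, involutionSqrt, OneMemClass.coe_one, ← add_smul, ← add_div,
    add_add_sub_cancel, one_add_one_eq_two, div_self two_ne_zero, one_smul]

theorem sqrtPauli_mul_self (v : Label n) : sqrtPauli ω v * sqrtPauli ω v = pauliOp ω v :=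
  Subtype.ext (involutionSqrt_mul_self ω (coe_pauliOp_mul_self v))

theorem sqrtPauli_pow_four (v : Label n) : sqrtPauli ω v ^ 4 = 1 := by
  rw [pow_mul (sqrtPauli ω v) 2 2, pow_two, pow_two, sqrtPauli_mul_self, pauliOp_mul_self]

theorem commute_sqrtPauli_pauliOp (hvw : sympForm v w = 0) :
    Commute (sqrtPauli ω v) (pauliOp ω w) :=
  Subtype.ext (commute_involutionSqrt_left ω (congrArg Subtype.val (commute_pauliOp hvw)))

theorem commute_of_mem_phases (hA : A ∈ phases n) (B : U n) : Commute A B := by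
  obtain ⟨a, ha⟩ := hA
  exact Subtype.ext (by simp [ha])

theorem gateScalar_mem_phases (ω : EighthRoot) (n : ℕ) : gateScalar ω n ∈ phases n :=
  ⟨(ω : ℂ) ^ 2, rfl⟩

/-! ### The action on Pauli operators -/

/-- Conjugation by `A` maps the Pauli operator with label `v` to the one with label `w`, up to
sign. -/
def ConjMaps (ω : EighthRoot) {n : ℕ} (A : U n) (v w : Label n) : Prop :=
  A * pauliOp ω v * A⁻¹ = pauliOp ω w ∨ A * pauliOp ω v * A⁻¹ = -pauliOp ω w

/-- Two involutions that are proportional agree up to sign, so only proportionality has to be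
checked. -/
theorem conjMaps_iff_exists_smul :
    ConjMaps ω A v w ↔ ∃ c : ℂ, A.1 * (pauliOp ω v).1 = c • ((pauliOp ω w).1 * A.1) := by
  simp only [ConjMaps, mul_inv_eq_iff_eq_mul, Subtype.ext_iff, neg_mul, Unitary.coe_neg,
    Submonoid.coe_mul]
  constructor
  · rintro (h | h)
    · exact ⟨1, by rw [h, one_smul]⟩
    · exact ⟨-1, by rw [h, neg_smul, one_smul]⟩
  · rintro ⟨c, hc⟩
    have hsq : (c * c) • A.1 = (1 : ℂ) • A.1 := by
      calc (c * c) • A.1 = c • ((pauliOp ω w).1 * (c • ((pauliOp ω w).1 * A.1))) := by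
            rw [mul_smul_comm, ← mul_assoc, coe_pauliOp_mul_self, one_mul, smul_smul]
        _ = A.1 * (pauliOp ω v).1 * (pauliOp ω v).1 := by
            rw [← hc, ← mul_assoc, ← smul_mul_assoc, ← hc]
        _ = (1 : ℂ) • A.1 := by rw [mul_assoc, coe_pauliOp_mul_self, mul_one, one_smul]
    rcases mul_self_eq_one_iff.mp (smul_left_injective ℂ (coe_unitary_ne_zero A) hsq) with
      rfl | rfl
    · exact Or.inl (by rw [hc, one_smul])
    · exact Or.inr (by rw [hc, neg_smul, one_smul])

theorem conjMaps_of_semiconjBy (hA : SemiconjBy A (pauliOp ω v) (pauliOp ω w)) :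
    ConjMaps ω A v w :=
  Or.inl (mul_inv_eq_iff_eq_mul.mpr hA.eq)

theorem conjMaps_of_commute (hA : Commute A (pauliOp ω v)) : ConjMaps ω A v v :=
  conjMaps_of_semiconjBy hA

theorem ConjMaps.mul (hB : ConjMaps ω B v w) (hA : ConjMaps ω A u v) :
    ConjMaps ω (B * A) u w := by
  have hconj : B * A * pauliOp ω u * (B * A)⁻¹ = B * (A * pauliOp ω u * A⁻¹) * B⁻¹ := by group
  rw [ConjMaps, hconj]
  rcases hA with hA | hA <;> rcases hB with hB | hB <;> simp [hA, hB]

theorem ConjMaps.inv (hA : ConjMaps ω A v w) : ConjMaps ω A⁻¹ w v := by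
  have hconj : A⁻¹ * (A * pauliOp ω v * A⁻¹) * A = pauliOp ω v := by group
  rw [ConjMaps, inv_inv]
  rcases hA with hA | hA
  · exact Or.inl (hA ▸ hconj)
  · rw [hA, mul_neg, neg_mul] at hconj
    exact Or.inr (neg_eq_iff_eq_neg.mp hconj)

theorem ConjMaps.add (hv : ConjMaps ω A v v') (hw : ConjMaps ω A w w') :
    ConjMaps ω A (v + w) (v' + w') := by
  obtain ⟨a, ha⟩ := conjMaps_iff_exists_smul.mp hv
  obtain ⟨b, hb⟩ := conjMaps_iff_exists_smul.mp hw
  obtain ⟨c, hc, hvw⟩ := pauliOp_mul (ω := ω) v w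
  have hc₀ : c ≠ 0 := (IsUnit.of_pow_eq_one hc four_ne_zero).ne_zero
  obtain ⟨d, -, hvw'⟩ := pauliOp_mul (ω := ω) v' w'
  refine conjMaps_iff_exists_smul.mpr ⟨c⁻¹ * (a * b * d), ?_⟩
  calc A.1 * (pauliOp ω (v + w)).1
      = c⁻¹ • (A.1 * (pauliOp ω v).1 * (pauliOp ω w).1) := by
        rw [mul_assoc, hvw, mul_smul_comm, inv_smul_smul₀ hc₀]
    _ = (c⁻¹ * (a * b)) • ((pauliOp ω v').1 * (pauliOp ω w').1 * A.1) := by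
        rw [ha, smul_mul_assoc, mul_assoc, hb, mul_smul_comm, smul_smul, smul_smul, mul_assoc,
          mul_assoc]
    _ = (c⁻¹ * (a * b * d)) • ((pauliOp ω (v' + w')).1 * A.1) := by
        rw [hvw', smul_mul_assoc, smul_smul, mul_assoc]

theorem ConjMaps.sympForm_eq (hv : ConjMaps ω A v v') (hw : ConjMaps ω A w w') :
    sympForm v' w' = sympForm v w := by
  have hcomm : Commute (pauliOp ω v') (pauliOp ω w') ↔ Commute (pauliOp ω v) (pauliOp ω w) := by
    rw [← Commute.conj_iff A (a := pauliOp ω v)]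
    rcases hv with hv | hv <;> rcases hw with hw | hw <;>
      simp only [hv, hw, Commute.neg_left_iff, Commute.neg_right_iff]
  have eq_of_eq_zero_iff : ∀ a b : ZMod 2, (a = 0 ↔ b = 0) → a = b := by decide
  exact eq_of_eq_zero_iff _ _ (by simpa only [commute_pauliOp_iff] using hcomm)

theorem sqrtPauli_conjMaps_add (hvw : sympForm v w = 1) :
    ConjMaps ω (sqrtPauli ω v) w (v + w) := by
  obtain ⟨c, -, hc⟩ := pauliOp_mul (ω := ω) v w
  refine conjMaps_iff_exists_smul.mpr ⟨-(ω : ℂ) ^ 2 * c, ?_⟩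
  rw [coe_sqrtPauli, involutionSqrt_mul_of_anticomm ω (coe_pauliOp_mul_self v)
    (pauliOp_anticomm hvw), hc, smul_mul_assoc, smul_smul]

theorem exists_sqrtPauli_conjMaps (v w : Label n) : ∃ u, ConjMaps ω (sqrtPauli ω v) w u := by
  rcases eq_zero_or_eq_one (sympForm v w) with hvw | hvw
  · exact ⟨w, conjMaps_of_commute (commute_sqrtPauli_pauliOp hvw)⟩
  · exact ⟨v + w, sqrtPauli_conjMaps_add hvw⟩

theorem conj_sqrtPauli (hA : ConjMaps ω A v w) :
    A * sqrtPauli ω v * A⁻¹ = sqrtPauli ω w ∨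
      A * sqrtPauli ω v * A⁻¹ = (sqrtPauli ω w)⁻¹ * gateScalar ω n := by
  have hconj : (A * sqrtPauli ω v * A⁻¹).1 = involutionSqrt ω (A * pauliOp ω v * A⁻¹).1 :=
    mul_involutionSqrt_mul ω (congrArg Subtype.val (mul_inv_cancel A))
  rcases hA with hA | hA
  · exact Or.inl (Subtype.ext (by rw [hconj, hA, coe_sqrtPauli]))
  · refine Or.inr (eq_inv_mul_iff_mul_eq.mpr (Subtype.ext ?_))
    rw [Submonoid.coe_mul, hconj, hA, Unitary.coe_neg]
    exact involutionSqrt_mul_involutionSqrt_neg ω (coe_pauliOp_mul_self w)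

theorem conj_sqrtPauli_mem_iff {K : Subgroup (U n)} (hK : phases n ≤ K)
    (hA : ConjMaps ω A v w) : A * sqrtPauli ω v * A⁻¹ ∈ K ↔ sqrtPauli ω w ∈ K := by
  rcases conj_sqrtPauli hA with hconj | hconj
  · rw [hconj]
  · rw [hconj, K.mul_mem_cancel_right (hK (gateScalar_mem_phases ω n)), inv_mem_iff]

theorem sqrtPauli_mem_of_conjMaps {K : Subgroup (U n)} (hK : phases n ≤ K) (hAK : A ∈ K)
    (hA : ConjMaps ω A v w) (hv : sqrtPauli ω v ∈ K) : sqrtPauli ω w ∈ K :=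
  (conj_sqrtPauli_mem_iff hK hA).mp (mul_mem (mul_mem hAK hv) (inv_mem hAK))

theorem pauliOp_mem_of_sqrtPauli_mem {K : Subgroup (U n)} (hv : sqrtPauli ω v ∈ K) :
    pauliOp ω v ∈ K :=
  sqrtPauli_mul_self (ω := ω) v ▸ mul_mem hv hv

/-! ### Pauli and Clifford operators -/

theorem EighthRoot.eq_sq_pow_of_pow_four (ω : EighthRoot) {c : ℂ} (hc : c ^ 4 = 1) :
    ∃ k, ((ω : ℂ) ^ 2) ^ k = c := by
  obtain ⟨k, -, hk⟩ := (ω.2.pow (by norm_num) (by norm_num : 8 = 2 * 4)).eq_pow_of_pow_eq_one hc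
  exact ⟨k, hk⟩

theorem coe_gateScalar_pow_mul (k : ℕ) (A : U n) :
    (gateScalar ω n ^ k * A).1 = ((ω : ℂ) ^ 2) ^ k • A.1 := by
  simp only [gateScalar, Submonoid.coe_mul, SubmonoidClass.coe_pow, smul_pow, one_pow,
    smul_mul_assoc, one_mul]

theorem mem_pauli_of_eq_smul (hA : A ∈ Pauli ω n) {c : ℂ} (hc : c ^ 4 = 1)
    (hBA : B.1 = c • A.1) : B ∈ Pauli ω n := by
  obtain ⟨k, rfl⟩ := ω.eq_sq_pow_of_pow_four hc
  have hB : B = gateScalar ω n ^ k * A := Subtype.ext (by rw [coe_gateScalar_pow_mul, hBA])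
  exact hB ▸ mul_mem (pow_mem (gateScalar_mem_pauli ω n) k) hA

theorem pauliOp_mem_pauli (v : Label n) : pauliOp ω v ∈ Pauli ω n := by
  induction v using label_induction with
  | zero => exact pauliOp_zero (ω := ω) (n := n) ▸ one_mem _
  | add v w hv hw =>
    obtain ⟨c, hc, hvw⟩ := pauliOp_mul (ω := ω) v w
    refine mem_pauli_of_eq_smul (mul_mem hv hw) (c := c⁻¹) (by rw [inv_pow, hc, inv_one]) ?_
    rw [Submonoid.coe_mul, hvw, inv_smul_smul₀]
    exact (IsUnit.of_pow_eq_one hc four_ne_zero).ne_zero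
  | x i => exact gateX_eq_pauliOp (ω := ω) i ▸ gateX_mem_pauli ω i
  | z i => exact gateZ_eq_pauliOp (ω := ω) i ▸ gateZ_mem_pauli ω i

theorem exists_eq_smul_pauliOp (hA : A ∈ Pauli ω n) :
    ∃ (c : ℂ) (v : Label n), A.1 = c • (pauliOp ω v).1 := by
  induction hA using Subgroup.closure_induction with
  | mem A hA =>
    rcases hA with (⟨i, rfl⟩ | ⟨i, rfl⟩) | rfl
    · exact ⟨1, xLabel i, by rw [one_smul, gateX_eq_pauliOp]⟩
    · exact ⟨1, zLabel i, by rw [one_smul, gateZ_eq_pauliOp]⟩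
    · exact ⟨(ω : ℂ) ^ 2, 0, by rw [pauliOp_zero]; rfl⟩
  | one => exact ⟨1, 0, by rw [one_smul, pauliOp_zero]⟩
  | mul A B _ _ hA hB =>
    obtain ⟨a, v, hA⟩ := hA
    obtain ⟨b, w, hB⟩ := hB
    obtain ⟨c, -, hvw⟩ := pauliOp_mul (ω := ω) v w
    exact ⟨a * b * c, v + w, by
      rw [Submonoid.coe_mul, hA, hB, smul_mul_smul_comm, hvw, smul_smul]⟩
  | inv A _ hA =>
    obtain ⟨c, v, hA⟩ := hA
    exact ⟨star c, v, by
      rw [Matrix.UnitaryGroup.inv_val, hA, star_smul, star_coe_pauliOp]⟩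

theorem exists_conjMaps (hA : A ∈ Clifford ω n) (v : Label n) : ∃ w, ConjMaps ω A v w := by
  obtain ⟨c, w, hw⟩ := exists_eq_smul_pauliOp
    ((Subgroup.mem_normalizer_iff.mp hA (pauliOp ω v)).mp (pauliOp_mem_pauli v))
  refine ⟨w, conjMaps_iff_exists_smul.mpr ⟨c, ?_⟩⟩
  rw [← smul_mul_assoc, ← hw, ← Submonoid.coe_mul, ← Submonoid.coe_mul, inv_mul_cancel_right]

theorem ConjMaps.ne_zero (hA : A ∈ Clifford ω n) (hvw : ConjMaps ω A v w) (hv : v ≠ 0) :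
    w ≠ 0 := by
  rintro rfl
  have hv_mem : v ∈ supportedFrom n 0 := fun _ hi => absurd hi (Nat.not_lt_zero _)
  obtain ⟨u, -, hu⟩ := exists_sympForm_eq_one hv_mem hv
  obtain ⟨u', hu'⟩ := exists_conjMaps hA u
  have hzero : sympForm (0 : Label n) u' = 0 := by simp [sympForm, qubitForm]
  exact zero_ne_one (hzero.symm.trans ((hvw.sympForm_eq hu').trans hu))

theorem ConjMaps.exists_mul_eq (hA : ConjMaps ω A v w) :
    ∃ P ∈ Pauli ω n, A * pauliOp ω v = P * A := by
  refine ⟨A * pauliOp ω v * A⁻¹, ?_, by group⟩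
  rcases hA with hA | hA
  · exact hA ▸ pauliOp_mem_pauli w
  · rw [hA]
    exact mem_pauli_of_eq_smul (pauliOp_mem_pauli w) (c := -1) (by norm_num)
      (by rw [neg_smul, one_smul, Unitary.coe_neg])

theorem sqrtPauli_mem_clifford (v : Label n) : sqrtPauli ω v ∈ Clifford ω n := by
  have hconj (w : Label n) : ∃ P ∈ Pauli ω n, sqrtPauli ω v * pauliOp ω w = P * sqrtPauli ω v :=
    (exists_sqrtPauli_conjMaps v w).elim fun _ hu => hu.exists_mul_eq
  refine mem_clifford_of_gen ω _ (sqrtPauli_pow_four v) (fun i => ?_) (fun i => ?_)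
  · exact gateX_eq_pauliOp (ω := ω) i ▸ hconj _
  · exact gateZ_eq_pauliOp (ω := ω) i ▸ hconj _

theorem phases_le_clifford : phases n ≤ Clifford ω n := by
  intro A hA
  rw [Clifford, Subgroup.mem_normalizer_iff]
  intro P
  rw [(commute_of_mem_phases hA P).eq, mul_inv_cancel_right]

end

/-! ### Operators commuting with all Pauli operators -/

section

variable {n : ℕ} {A : Matrix (Basis n) (Basis n) ℂ} {i : Fin n}

theorem apply_eq_zero_of_commute_matZ (hA : Commute A (onQubit i matZ)) {x y : Basis n}
    (hxy : x i ≠ y i) : A x y = 0 := by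
  have hentry := congrFun (congrFun hA.eq x) y
  rw [onQubit_matZ, Matrix.mul_diagonal, Matrix.diagonal_mul] at hentry
  have one_cases : ∀ a b : Fin 2, a ≠ b → (a = 1 ∧ b ≠ 1) ∨ (a ≠ 1 ∧ b = 1) := by decide
  rcases one_cases _ _ hxy with ⟨hx, hy⟩ | ⟨hx, hy⟩
  · rw [if_pos hx, if_neg hy] at hentry
    linear_combination (1 / 2 : ℂ) * hentry
  · rw [if_neg hx, if_pos hy] at hentry
    linear_combination (-1 / 2 : ℂ) * hentry

theorem onQubit_matX_apply (i : Fin n) (x y : Basis n) :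
    onQubit i matX x y = if y = Function.update x i (x i + 1) then 1 else 0 := by
  have matX_apply : ∀ a b : Fin 2, matX a b = if b = a + 1 then 1 else 0 := by
    intro a b
    fin_cases a <;> fin_cases b <;> simp [matX]
  simp only [onQubit_apply, matX_apply, Function.eq_update_iff, ite_and, eq_comm (a := x _)]
  split_ifs <;> rfl

theorem apply_update_of_commute_matX (hA : Commute A (onQubit i matX)) (x y : Basis n) :
    A (Function.update x i (x i + 1)) (Function.update y i (y i + 1)) = A x y := by
  have hflip : Function.Involutive fun z : Basis n => Function.update z i (z i + 1) := fun z => by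
    simp [add_assoc]
  have hentry := congrFun (congrFun hA.eq x) (Function.update y i (y i + 1))
  simp only [Matrix.mul_apply, onQubit_matX_apply, ite_mul, one_mul, zero_mul, Finset.sum_ite_eq',
    Finset.mem_univ, if_true] at hentry
  rw [← hentry, Finset.sum_eq_single_of_mem y (Finset.mem_univ y), if_pos rfl, mul_one]
  intro z _ hzy
  rw [if_neg fun hz => hzy (hflip.injective hz.symm), mul_zero]

theorem eq_of_update_eq {ι α β : Type*} [Finite ι] [DecidableEq ι] {f : (ι → α) → β}
    (hf : ∀ x i a, f (Function.update x i a) = f x) (x y : ι → α) : f x = f y := by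
  have := Fintype.ofFinite ι
  suffices ∀ t : Finset ι, f (t.piecewise x y) = f y by
    rw [← this Finset.univ, Finset.piecewise_univ]
  intro t
  induction t using Finset.induction_on with
  | empty => rw [Finset.piecewise_empty]
  | insert i t _ ih => rw [Finset.piecewise_insert, hf, ih]

theorem eq_smul_one_of_commute (hX : ∀ i, Commute A (onQubit i matX))
    (hZ : ∀ i, Commute A (onQubit i matZ)) : A = A 0 0 • 1 := by
  have hdiag : ∀ x i a, A (Function.update x i a) (Function.update x i a) = A x x := by
    intro x i a
    have eq_or_eq_add_one : ∀ a b : Fin 2, a = b ∨ a = b + 1 := by decide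
    rcases eq_or_eq_add_one a (x i) with rfl | rfl
    · rw [Function.update_eq_self]
    · exact apply_update_of_commute_matX (hX i) x x
  ext x y
  rcases eq_or_ne x y with rfl | hxy
  · simpa using eq_of_update_eq (f := fun x => A x x) hdiag x 0
  · obtain ⟨i, hi⟩ := Function.ne_iff.mp hxy
    rw [apply_eq_zero_of_commute_matZ (hZ i) hi, Matrix.smul_apply, Matrix.one_apply_ne hxy,
      smul_zero]

end

/-- The operators that commute with the Pauli operators on the first `k` qubits. -/
def fixingBelow (ω : EighthRoot) (n k : ℕ) : Subgroup (U n) :=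
  ⨅ (i : Fin n) (_ : (i : ℕ) < k),
    Subgroup.centralizer {pauliOp ω (xLabel i), pauliOp ω (zLabel i)}

section

variable {ω : EighthRoot} {n k : ℕ} {A B : U n} {u v w : Label n}

theorem mem_fixingBelow : A ∈ fixingBelow ω n k ↔ ∀ i : Fin n, (i : ℕ) < k →
    Commute A (pauliOp ω (xLabel i)) ∧ Commute A (pauliOp ω (zLabel i)) := by
  simp only [fixingBelow, Subgroup.mem_iInf, Subgroup.mem_centralizer_iff, Set.forall_mem_insert,
    Set.mem_singleton_iff, forall_eq, commute_iff_eq, eq_comm]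

theorem mem_fixingBelow_succ {i : Fin n} (hA : A ∈ fixingBelow ω n i)
    (hx : Commute A (pauliOp ω (xLabel i))) (hz : Commute A (pauliOp ω (zLabel i))) :
    A ∈ fixingBelow ω n (i + 1) := by
  refine mem_fixingBelow.mpr fun j hj => ?_
  rcases Nat.lt_succ_iff_lt_or_eq.mp hj with hlt | heq
  · exact mem_fixingBelow.mp hA j hlt
  · rw [Fin.ext heq]
    exact ⟨hx, hz⟩

theorem mem_phases_of_mem_fixingBelow (hA : A ∈ fixingBelow ω n n) : A ∈ phases n := by
  have hcomm (i : Fin n) := mem_fixingBelow.mp hA i i.2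
  refine ⟨A.1 0 0, eq_smul_one_of_commute (fun i => ?_) fun i => ?_⟩
  · exact congrArg Subtype.val (gateX_eq_pauliOp (ω := ω) i ▸ (hcomm i).1.eq)
  · exact congrArg Subtype.val (gateZ_eq_pauliOp (ω := ω) i ▸ (hcomm i).2.eq)

theorem sqrtPauli_mem_fixingBelow (hv : v ∈ supportedFrom n k) :
    sqrtPauli ω v ∈ fixingBelow ω n k :=
  mem_fixingBelow.mpr fun i hi =>
    ⟨commute_sqrtPauli_pauliOp (by rw [sympForm_single, hv i hi]; rfl),
      commute_sqrtPauli_pauliOp (by rw [sympForm_single, hv i hi]; rfl)⟩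

theorem ConjMaps.mem_supportedFrom (hA : A ∈ fixingBelow ω n k) (hvw : ConjMaps ω A v w)
    (hv : v ∈ supportedFrom n k) : w ∈ supportedFrom n k := by
  intro i hi
  obtain ⟨hx, hz⟩ := mem_fixingBelow.mp hA i hi
  have hwx := hvw.sympForm_eq (conjMaps_of_commute hx)
  have hwz := hvw.sympForm_eq (conjMaps_of_commute hz)
  rw [sympForm_single, sympForm_single, hv i hi] at hwx hwz
  have eq_zero_of_qubitForm : ∀ a : ZMod 2 × ZMod 2, qubitForm a (1, 0) = qubitForm 0 (1, 0) →
      qubitForm a (0, 1) = qubitForm 0 (0, 1) → a = 0 := by decide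
  exact eq_zero_of_qubitForm _ hwx hwz

/-! ### Correcting Clifford operators by transvections -/

theorem sqrtPauli_add_conjMaps (huv : sympForm u v = 1) :
    ConjMaps ω (sqrtPauli ω (u + v)) u v := by
  have hform : sympForm (u + v) u = 1 := by
    rw [sympForm_add_left, sympForm_self, sympForm_comm, huv, zero_add]
  have hmaps := sqrtPauli_conjMaps_add (ω := ω) hform
  rwa [add_comm u v, add_assoc, ZModModule.add_self, add_zero, add_comm v u] at hmaps

theorem exists_commute_of_conjMaps {L : Subgroup (U n)} (hv : sqrtPauli ω v ∈ L)
    (hvu : sympForm v u = 1) (hBL : B ∈ L) (hBA : ConjMaps ω (B * A) u u) :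
    ∃ B ∈ L, Commute (B * A) (pauliOp ω u) := by
  rcases hBA with hBA | hBA
  · exact ⟨B, hBL, mul_inv_eq_iff_eq_mul.mp hBA⟩
  · refine ⟨pauliOp ω v * B, mul_mem (pauliOp_mem_of_sqrtPauli_mem hv) hBL, ?_⟩
    have hanti : pauliOp ω v * pauliOp ω u = -(pauliOp ω u * pauliOp ω v) :=
      Subtype.ext (pauliOp_anticomm hvu)
    rw [mul_inv_eq_iff_eq_mul] at hBA
    rw [commute_iff_eq, mul_assoc _ B, mul_assoc, hBA, neg_mul, mul_neg, ← mul_assoc, hanti,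
      neg_mul, neg_neg, mul_assoc]

theorem exists_commute_zLabel {L : Subgroup (U n)} {k : Fin n}
    (hL : ∀ v ∈ supportedFrom n k, sqrtPauli ω v ∈ L) (hAC : A ∈ Clifford ω n)
    (hA : A ∈ fixingBelow ω n k) : ∃ B ∈ L, Commute (B * A) (pauliOp ω (zLabel k)) := by
  obtain ⟨q, hq⟩ := exists_conjMaps hAC (zLabel k)
  have hz : zLabel k ∈ supportedFrom n k := single_mem_supportedFrom le_rfl _
  have hqk := hq.mem_supportedFrom hA hz
  obtain ⟨w, hw, hqw, hzw⟩ := exists_sympForm_eq_one_pair hqk (hq.ne_zero hAC (zLabel_ne_zero k)) hz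
    (zLabel_ne_zero k)
  have hqz : ConjMaps ω (sqrtPauli ω (w + zLabel k) * sqrtPauli ω (q + w)) q (zLabel k) :=
    (sqrtPauli_add_conjMaps (sympForm_comm _ w ▸ hzw)).mul (sqrtPauli_add_conjMaps hqw)
  exact exists_commute_of_conjMaps (hL _ (single_mem_supportedFrom le_rfl (1, 0)))
    (sympForm_xLabel_zLabel k)
    (mul_mem (hL _ (add_mem hw hz)) (hL _ (add_mem hqk hw))) (hqz.mul hq)

theorem exists_commute_xLabel {L : Subgroup (U n)} {k : Fin n}
    (hL : ∀ v ∈ supportedFrom n k, sympForm v (zLabel k) = 0 → sqrtPauli ω v ∈ L)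
    (hAC : A ∈ Clifford ω n) (hA : A ∈ fixingBelow ω n k)
    (hAz : Commute A (pauliOp ω (zLabel k))) :
    ∃ B ∈ L, Commute (B * A) (pauliOp ω (xLabel k)) := by
  obtain ⟨q, hq⟩ := exists_conjMaps hAC (xLabel k)
  have hx : xLabel k ∈ supportedFrom n k := single_mem_supportedFrom le_rfl _
  have hz : zLabel k ∈ supportedFrom n k := single_mem_supportedFrom le_rfl _
  have hxz := sympForm_xLabel_zLabel k
  have hzx := sympForm_zLabel_xLabel k
  have hqk := hq.mem_supportedFrom hA hx
  have hqz : sympForm q (zLabel k) = 1 := (hq.sympForm_eq (conjMaps_of_commute hAz)).trans hxz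
  have hzL := hL _ hz (sympForm_self _)
  have hsumL {w : Label n} (hw : w ∈ supportedFrom n k) (hwz : sympForm w (zLabel k) = 1) :
      sqrtPauli ω (w + xLabel k) ∈ L :=
    hL _ (add_mem hw hx) (by rw [sympForm_add_left, hwz, hxz, CharTwo.add_self_eq_zero])
  obtain ⟨B, hBL, hBq⟩ : ∃ B ∈ L, ConjMaps ω B q (xLabel k) := by
    rcases eq_zero_or_eq_one (sympForm q (xLabel k)) with hqx | hqx
    · have hwx : sympForm (zLabel k + q) (xLabel k) = 1 := by
        rw [sympForm_add_left, hzx, hqx, add_zero]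
      have hwz : sympForm (zLabel k + q) (zLabel k) = 1 := by
        rw [sympForm_add_left, sympForm_self, hqz, zero_add]
      exact ⟨_, mul_mem (hsumL (add_mem hz hqk) hwz) hzL,
        (sqrtPauli_add_conjMaps hwx).mul (sqrtPauli_conjMaps_add (sympForm_comm q _ ▸ hqz))⟩
    · exact ⟨_, hsumL hqk hqz, sqrtPauli_add_conjMaps hqx⟩
  exact exists_commute_of_conjMaps hzL hzx hBL (hBq.mul hq)

theorem exists_mem_fixingBelow_succ {K : Subgroup (U n)} {k : Fin n}
    (hK : ∀ v ∈ supportedFrom n k, sympForm v (zLabel k) = 0 → sqrtPauli ω v ∈ K)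
    (hAC : A ∈ Clifford ω n) (hA : A ∈ fixingBelow ω n k)
    (hAz : Commute A (pauliOp ω (zLabel k))) : ∃ B ∈ K, B * A ∈ fixingBelow ω n (k + 1) := by
  obtain ⟨B, ⟨⟨hBK, hB⟩, hBz⟩, hBx⟩ := exists_commute_xLabel
    (L := K ⊓ fixingBelow ω n k ⊓ Subgroup.centralizer {pauliOp ω (zLabel k)})
    (fun v hv hvz => ⟨⟨hK v hv hvz, sqrtPauli_mem_fixingBelow hv⟩,
      Subgroup.mem_centralizer_singleton_iff.mpr (commute_sqrtPauli_pauliOp hvz).eq⟩) hAC hA hAz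
  have hBz : Commute B (pauliOp ω (zLabel k)) := Subgroup.mem_centralizer_singleton_iff.mp hBz
  exact ⟨B, hBK, mem_fixingBelow_succ (mul_mem hB hA) hBx (hBz.mul_left hAz)⟩

theorem mem_of_mem_fixingBelow {K : Subgroup (U n)} (hphases : phases n ≤ K)
    (hKC : K ≤ Clifford ω n) (hk : k ≤ n) (hK : ∀ v ∈ supportedFrom n k, sqrtPauli ω v ∈ K)
    (hAC : A ∈ Clifford ω n) (hA : A ∈ fixingBelow ω n k) : A ∈ K := by
  induction hk using Nat.decreasingInduction generalizing A with
  | self => exact hphases (mem_phases_of_mem_fixingBelow hA)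
  | of_succ k hkn ih =>
    obtain ⟨B, ⟨hBK, hB⟩, hBz⟩ := exists_commute_zLabel (k := ⟨k, hkn⟩) (L := K ⊓ fixingBelow ω n k)
      (fun v hv => ⟨hK v hv, sqrtPauli_mem_fixingBelow hv⟩) hAC hA
    have hBAC := mul_mem (hKC hBK) hAC
    have hBA : B * A ∈ fixingBelow ω n k := mul_mem hB hA
    obtain ⟨D, hDK, hD⟩ := exists_mem_fixingBelow_succ (k := ⟨k, hkn⟩) (K := K)
      (fun v hv _ => hK v hv) hBAC hBA hBz
    have hmem := ih (fun v hv => hK v (supportedFrom_anti k.le_succ hv))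
      (mul_mem (hKC hDK) hBAC) hD
    rwa [K.mul_mem_cancel_left hDK, K.mul_mem_cancel_left hBK] at hmem

theorem mem_of_commute_zLabel_zero [NeZero n] {K : Subgroup (U n)} (hphases : phases n ≤ K)
    (hKC : K ≤ Clifford ω n) (hK : ∀ v : Label n, sympForm v (zLabel 0) = 0 → sqrtPauli ω v ∈ K)
    (hAC : A ∈ Clifford ω n) (hA : Commute A (pauliOp ω (zLabel 0))) : A ∈ K := by
  obtain ⟨B, hBK, hB⟩ := exists_mem_fixingBelow_succ (k := 0) (fun v _ hv => hK v hv) hAC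
    (mem_fixingBelow.mpr fun i hi => absurd hi (by simp)) hA
  have hmem := mem_of_mem_fixingBelow hphases hKC (Nat.one_le_iff_ne_zero.mpr (NeZero.ne n))
    (fun v hv => hK v (by rw [sympForm_single, hv 0 (by simp)]; rfl)) (mul_mem (hKC hBK) hAC)
    (by simpa using hB)
  rwa [K.mul_mem_cancel_left hBK] at hmem

end

/-! ### Generating labels by transvections -/

/-- Sets of labels closed under transvections by their members. The labels `v` for which a subgroup
contains `sqrtPauli ω v` form such a set. -/
structure TransvectionClosed {n : ℕ} (T : Set (Label n)) : Prop where
  zero_mem : 0 ∈ T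
  add_mem : ∀ ⦃u v⦄, u ∈ T → v ∈ T → sympForm u v = 1 → u + v ∈ T

namespace TransvectionClosed

variable {n k : ℕ} {T : Set (Label n)} {i j l : Fin n}

theorem single_mem (hT : TransvectionClosed T) (hx : xLabel i ∈ T) (hz : zLabel i ∈ T)
    (a : ZMod 2 × ZMod 2) : Pi.single i a ∈ T := by
  have hy := hT.add_mem hx hz (sympForm_xLabel_zLabel i)
  rw [← Pi.single_add] at hy
  have bits_cases : ∀ a : ZMod 2 × ZMod 2,
      a = 0 ∨ a = (1, 0) ∨ a = (0, 1) ∨ a = (1, 0) + (0, 1) := by decide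
  rcases bits_cases a with rfl | rfl | rfl | rfl
  · exact (Pi.single_zero (M := fun _ => ZMod 2 × ZMod 2) i).symm ▸ hT.zero_mem
  · exact hx
  · exact hz
  · exact hy

theorem add_single_mem (hT : TransvectionClosed T) (hi : ∀ a, Pi.single i a ∈ T) {v : Label n}
    (hv : v ∈ T) {a : ZMod 2 × ZMod 2} (hvi : v i ≠ 0) (hva : v i + a ≠ 0) :
    v + Pi.single i a ∈ T := by
  rcases eq_or_ne a 0 with rfl | ha
  · rwa [Pi.single_zero, add_zero]
  have qubitForm_eq_one : ∀ a b : ZMod 2 × ZMod 2, a ≠ 0 → b ≠ 0 → a + b ≠ 0 →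
      qubitForm a b = 1 := by decide
  exact hT.add_mem hv (hi a) (by rw [sympForm_single, qubitForm_eq_one _ _ hvi ha hva])

theorem pair_mem (hT : TransvectionClosed T) (hij : i ≠ j) (hi : ∀ a, Pi.single i a ∈ T)
    (hj : ∀ a, Pi.single j a ∈ T) (hzz : zLabel i + zLabel j ∈ T) (a b : ZMod 2 × ZMod 2) :
    Pi.single i a + Pi.single j b ∈ T := by
  rcases eq_or_ne a 0 with rfl | ha
  · simpa using hj b
  rcases eq_or_ne b 0 with rfl | hb
  · simpa using hi a
  have add_add_cancel : ∀ c : ZMod 2 × ZMod 2, (0, 1) + ((0, 1) + c) = c := by decide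
  have hab := hT.add_single_mem hj (a := (0, 1) + b)
    (hT.add_single_mem hi (a := (0, 1) + a) hzz (by simp [hij]) (by simp [hij, add_add_cancel, ha]))
    (by simp [hij]) (by simp [hij, add_add_cancel, hb])
  rwa [add_right_comm (zLabel i), ← Pi.single_add, add_add_cancel, add_assoc, ← Pi.single_add,
    add_add_cancel] at hab

theorem pair_mem_trans (hT : TransvectionClosed T) (hij : i ≠ j) (hjl : j ≠ l) (hil : i ≠ l)
    (hpij : ∀ a b, Pi.single i a + Pi.single j b ∈ T)
    (hpjl : ∀ a b, Pi.single j a + Pi.single l b ∈ T) (a b : ZMod 2 × ZMod 2) :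
    Pi.single i a + Pi.single l b ∈ T := by
  have hi (a) : Pi.single i a ∈ T := by simpa using hpij a 0
  have hl (b) : Pi.single l b ∈ T := by simpa using hpjl 0 b
  rcases eq_or_ne b 0 with rfl | hb
  · simpa using hi a
  have hxz : sympForm (Pi.single i a + xLabel j) (zLabel j + xLabel l) = 1 := by
    simp [sympForm_add_right, sympForm_single, qubitForm, hij.symm, hil.symm, hjl.symm]
  have hyx := hT.add_mem (hpij a (1, 0)) (hpjl (0, 1) (1, 0)) hxz
  have hyy : sympForm (Pi.single i a + xLabel j + (zLabel j + xLabel l)) (yLabel j + yLabel l) =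
      1 := by
    simp [sympForm_add_right, sympForm_single, qubitForm, hij.symm, hil.symm, hjl, hjl.symm,
      CharTwo.add_self_eq_zero]
  have hz := hT.add_mem hyx (hpjl (1, 1) (1, 1)) hyy
  have hsum : Pi.single i a + xLabel j + (zLabel j + xLabel l) + (yLabel j + yLabel l) =
      Pi.single i a + zLabel l := by
    have hj : xLabel j + zLabel j + yLabel j = 0 := by
      rw [← Pi.single_add, ← Pi.single_add]
      exact Pi.single_zero j
    have hl : xLabel l + yLabel l = zLabel l := (Pi.single_add l _ _).symm
    calc _ = Pi.single i a + (xLabel j + zLabel j + yLabel j) + (xLabel l + yLabel l) := by abel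
      _ = _ := by rw [hj, hl, add_zero]
  have add_add_cancel : ∀ c : ZMod 2 × ZMod 2, (0, 1) + ((0, 1) + c) = c := by decide
  have hib := hT.add_single_mem hl (a := (0, 1) + b) (hsum ▸ hz) (by simp [hil.symm])
    (by simp [hil.symm, add_add_cancel, hb])
  rwa [add_assoc, ← Pi.single_add, add_add_cancel] at hib

theorem pair_mem_of_adjacent (hT : TransvectionClosed T)
    (hadj : ∀ (i : Fin n) (hi : (i : ℕ) + 1 < n), k ≤ i → ∀ a b,
      Pi.single i a + Pi.single ⟨i + 1, hi⟩ b ∈ T) (hki : k ≤ i) (hij : i < j)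
    (a b : ZMod 2 × ZMod 2) : Pi.single i a + Pi.single j b ∈ T := by
  obtain ⟨j, hj⟩ := j
  replace hij : (i : ℕ) + 1 ≤ j := hij
  induction j, hij using Nat.le_induction generalizing a b with
  | base => exact hadj i hj hki a b
  | succ j hij ih =>
    exact hT.pair_mem_trans (j := ⟨j, Nat.lt_of_succ_lt hj⟩) (Fin.ne_of_lt hij)
      (by simp [Fin.ext_iff]) (Fin.ne_of_lt (Nat.lt_succ_of_lt hij)) (fun a b => ih a b _)
      (hadj ⟨j, _⟩ hj (hki.trans (Nat.le_of_lt hij))) a b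

theorem mem_of_pair_mem (hT : TransvectionClosed T) (t : Finset (Fin n))
    (hsingle : ∀ i ∈ t, ∀ a, Pi.single i a ∈ T)
    (hpair : ∀ i ∈ t, ∀ j ∈ t, i ≠ j → ∀ a b, Pi.single i a + Pi.single j b ∈ T) {v : Label n}
    (hv : ∀ i ∉ t, v i = 0) : v ∈ T := by
  induction t using Finset.induction_on generalizing v with
  | empty => exact (funext fun i => hv i (Finset.notMem_empty i) : v = 0) ▸ hT.zero_mem
  | insert j t hjt ih =>
    have hj := Finset.mem_insert_self j t
    have ht {i : Fin n} (hi : i ∈ t) : i ∈ insert j t := Finset.mem_insert_of_mem hi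
    have ih := @ih (fun i hi => hsingle i (ht hi)) fun i hi l hl => hpair i (ht hi) l (ht hl)
    obtain ⟨u, hu, hut⟩ : ∃ u : Label n, u + Pi.single j (v j) = v ∧ ∀ i ∉ t, u i = 0 := by
      refine ⟨v + Pi.single j (v j), by rw [add_assoc, ZModModule.add_self, add_zero], ?_⟩
      intro i hi
      rcases eq_or_ne i j with rfl | hij
      · rw [Pi.add_apply, Pi.single_eq_same, ZModModule.add_self]
      · simp [hij, hv i (by simp [hij, hi])]
    rcases eq_or_ne u 0 with rfl | hu₀
    · rw [← hu, zero_add]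
      exact hsingle j hj _
    obtain ⟨p, hp⟩ := Function.ne_iff.mp hu₀
    have hpt : p ∈ t := by_contra fun hpt => hp (hut p hpt)
    have hpj : p ≠ j := ne_of_mem_of_not_mem hpt hjt
    obtain ⟨c, hc⟩ := exists_qubitForm_eq_one hp
    have huc : u + Pi.single p c ∈ T := ih fun i hi => by
      simp [hut i hi, (ne_of_mem_of_not_mem hpt hi).symm]
    have hform : sympForm (u + Pi.single p c) (Pi.single p c + Pi.single j (v j)) = 1 := by
      rw [sympForm_add_left, sympForm_add_right, sympForm_add_right, sympForm_self,
        sympForm_single, hc, sympForm_single, hut j hjt, sympForm_single,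
        Pi.single_eq_of_ne hpj.symm]
      simp [qubitForm]
    have hmem := hT.add_mem huc (hpair p (ht hpt) j hj hpj c (v j)) hform
    rwa [add_assoc, add_add_cancel_label, hu] at hmem

theorem mem_of_mem_supportedFrom (hT : TransvectionClosed T)
    (hx : ∀ i : Fin n, k ≤ i → xLabel i ∈ T) (hz : ∀ i : Fin n, k ≤ i → zLabel i ∈ T)
    (hzz : ∀ (i : Fin n) (hi : (i : ℕ) + 1 < n), k ≤ i → zLabel i + zLabel ⟨i + 1, hi⟩ ∈ T)
    {v : Label n} (hv : v ∈ supportedFrom n k) : v ∈ T := by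
  have hsingle (i : Fin n) (hi : k ≤ i) := hT.single_mem (hx i hi) (hz i hi)
  have hlt {i j : Fin n} (hki : k ≤ i) (hij : i < j) (a b) :
      Pi.single i a + Pi.single j b ∈ T := hT.pair_mem_of_adjacent
    (fun i hi hki => hT.pair_mem (by simp [Fin.ext_iff]) (hsingle i hki)
      (hsingle _ (Nat.le_succ_of_le hki)) (hzz i hi hki)) hki hij a b
  refine hT.mem_of_pair_mem (Finset.univ.filter fun i : Fin n => k ≤ i) (by simpa using hsingle)
    (fun i hi j hj hij a b => ?_) (fun i hi => hv i (by simpa using hi))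
  simp only [Finset.mem_filter_univ] at hi hj
  rcases hij.lt_or_gt with hij | hij
  · exact hlt hi hij a b
  · rw [add_comm]
    exact hlt hj hij b a

theorem add_mem_of_add_mem (hT : TransvectionClosed T) (hk : ∀ v ∈ supportedFrom n k, v ∈ T)
    {e : Label n} (he : ∀ v ∈ supportedFrom n k, sympForm e v = 0) {t v : Label n}
    (ht : t ∈ supportedFrom n k) (ht₀ : t ≠ 0) (het : e + t ∈ T) (hv : v ∈ supportedFrom n k)
    (hv₀ : v ≠ 0) : e + v ∈ T := by
  have add_mem_of_sympForm {u w : Label n} (hu : u ∈ supportedFrom n k)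
      (hw : w ∈ supportedFrom n k) (huw : sympForm u w = 1) (heu : e + u ∈ T) : e + w ∈ T := by
    have huw_mem := (supportedFrom n k).add_mem hu hw
    have hmem := hT.add_mem heu (hk _ huw_mem) (by
      rw [sympForm_add_left, he _ huw_mem, sympForm_add_right, sympForm_self, huw, zero_add,
        zero_add])
    rwa [add_assoc, add_add_cancel_label] at hmem
  obtain ⟨w, hw, htw, hvw⟩ := exists_sympForm_eq_one_pair ht ht₀ hv hv₀
  exact add_mem_of_sympForm hw hv (sympForm_comm v w ▸ hvw) (add_mem_of_sympForm ht hw htw het)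

/-- A label orthogonal to `Z` on the first qubit differs from one supported on the other qubits by
at most the label of that `Z`. -/
theorem mem_of_sympForm_zLabel_zero [NeZero n] (hT : TransvectionClosed T)
    (hz : zLabel 0 ∈ T) (htail : ∀ v ∈ supportedFrom n 1, v ∈ T)
    (ht : 2 ≤ n → ∃ t ∈ supportedFrom n 1, t ≠ 0 ∧ zLabel 0 + t ∈ T) {v : Label n}
    (hv : sympForm v (zLabel 0) = 0) : v ∈ T := by
  have eq_zero_or_z : ∀ a : ZMod 2 × ZMod 2, qubitForm a (0, 1) = 0 → a = 0 ∨ a = (0, 1) := by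
    decide
  obtain ⟨u, hu, hu₁⟩ : ∃ u : Label n, v = Pi.single 0 (v 0) + u ∧ u ∈ supportedFrom n 1 := by
    refine ⟨Pi.single 0 (v 0) + v, (add_add_cancel_label _ _).symm, fun i hi => ?_⟩
    obtain rfl : i = 0 := Fin.ext (by simpa using hi)
    rw [Pi.add_apply, Pi.single_eq_same, ZModModule.add_self]
  rw [sympForm_single] at hv
  rcases eq_zero_or_z _ hv with hv₀ | hv₀
  · rw [hu, hv₀, Pi.single_zero, zero_add]
    exact htail u hu₁
  rw [hu, hv₀]
  rcases eq_or_ne u 0 with rfl | hu₀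
  · rwa [add_zero]
  obtain ⟨i, hi⟩ := Function.ne_iff.mp hu₀
  have hi₁ : 1 ≤ (i : ℕ) := not_lt.mp fun hlt => hi (hu₁ i hlt)
  obtain ⟨t, ht₁, ht₀, hzt⟩ := ht (by omega)
  refine hT.add_mem_of_add_mem htail (fun w hw => ?_) ht₁ ht₀ hzt hu₁ hu₀
  rw [sympForm_single_left, hw 0 (by simp)]
  simp [qubitForm]

end TransvectionClosed

/-! ### The gates in terms of square roots of Pauli operators -/

section

variable {ω : EighthRoot} {n : ℕ} {A : U n} {i j k : Fin n} {v w : Label n}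

theorem involutionSqrt_one (ω : EighthRoot) : involutionSqrt ω (1 : ℂ) = 1 := by
  simp only [involutionSqrt, smul_eq_mul]
  ring

theorem involutionSqrt_neg_one (ω : EighthRoot) : involutionSqrt ω (-1 : ℂ) = (ω : ℂ) ^ 2 := by
  simp only [involutionSqrt, smul_eq_mul]
  ring

theorem involutionSqrt_diagonal {m : Type*} [Fintype m] [DecidableEq m] (d : m → ℂ) :
    involutionSqrt ω (Matrix.diagonal d) = Matrix.diagonal fun x => involutionSqrt ω (d x) := by
  simp only [involutionSqrt, ← Matrix.diagonal_one, ← Matrix.diagonal_smul, Matrix.diagonal_add]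
  rfl

theorem semiconjBy_sqrtPauli (hA : SemiconjBy A (pauliOp ω v) (pauliOp ω w)) :
    SemiconjBy A (sqrtPauli ω v) (sqrtPauli ω w) := by
  have hA' : A.1 * (pauliOp ω v).1 = (pauliOp ω w).1 * A.1 := congrArg Subtype.val hA.eq
  refine Subtype.ext ?_
  simp only [Submonoid.coe_mul, coe_sqrtPauli, involutionSqrt, mul_add, add_mul, mul_smul_comm,
    smul_mul_assoc, mul_one, one_mul, hA']

theorem commute_onQubit_pauliOp (hv : v i = 0) (B : Matrix (Fin 2) (Fin 2) ℂ) :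
    Commute (onQubit i B) (pauliOp ω v).1 := by
  rw [commute_iff_eq, coe_pauliOp, onQubit, tensorMat_mul, tensorMat_mul]
  congr 1
  funext k
  rcases eq_or_ne k i with rfl | hk
  · simp only [hv, pauliMat_zero, mul_one, one_mul]
  · simp only [Function.update_of_ne hk, mul_one, one_mul]

theorem pauliOp_single_add (hv : v i = 0) (a : ZMod 2 × ZMod 2) :
    pauliOp ω (Pi.single i a + v) = pauliOp ω (Pi.single i a) * pauliOp ω v := by
  refine Subtype.ext ?_
  rw [Submonoid.coe_mul, coe_pauliOp, coe_pauliOp, coe_pauliOp, tensorMat_mul]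
  congr 1
  funext k
  rcases eq_or_ne k i with rfl | hk
  · simp only [Pi.add_apply, hv, add_zero, pauliMat_zero, mul_one]
  · simp only [Pi.add_apply, Pi.single_eq_of_ne hk, zero_add, pauliMat_zero, one_mul]

theorem gateH_mul_self (i : Fin n) : gateH i * gateH i = 1 := Subtype.ext (by
  change onQubit i matH * onQubit i matH = 1
  rw [onQubit_mul, matH_mul_self, onQubit_one])

theorem inv_gateH (i : Fin n) : (gateH i)⁻¹ = gateH i :=
  inv_eq_of_mul_eq_one_left (gateH_mul_self i)

theorem inv_gateCZ (i j : Fin n) : (gateCZ i j)⁻¹ = gateCZ i j :=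
  inv_eq_of_mul_eq_one_left (Subtype.ext (matCZ_mul_self i j))

theorem matH_mul_matX : matH * matX = matZ * matH := by
  ext a b
  fin_cases a <;> fin_cases b <;> simp [matH, matX, matZ, Matrix.mul_apply, Fin.sum_univ_two]

theorem semiconjBy_gateH_x (i : Fin n) :
    SemiconjBy (gateH i) (pauliOp ω (xLabel i)) (pauliOp ω (zLabel i)) := by
  rw [← gateX_eq_pauliOp, ← gateZ_eq_pauliOp]
  refine Subtype.ext ?_
  change onQubit i matH * onQubit i matX = onQubit i matZ * onQubit i matH
  rw [onQubit_mul, onQubit_mul, matH_mul_matX]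

theorem semiconjBy_gateH_z (i : Fin n) :
    SemiconjBy (gateH i) (pauliOp ω (zLabel i)) (pauliOp ω (xLabel i)) := by
  have hinv := (semiconjBy_gateH_x (ω := ω) i).inv_symm_left
  rwa [inv_gateH] at hinv

theorem commute_gateH_pauliOp (hv : v i = 0) : Commute (gateH i) (pauliOp ω v) :=
  Subtype.ext (commute_onQubit_pauliOp hv matH)

theorem commute_gateCZ_pauliOp_zLabel (i j k : Fin n) :
    Commute (gateCZ i j) (pauliOp ω (zLabel k)) := by
  rw [← gateZ_eq_pauliOp]
  refine Subtype.ext ?_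
  change matCZ i j * onQubit k matZ = onQubit k matZ * matCZ i j
  rw [onQubit_matZ, matCZ, Matrix.diagonal_mul_diagonal, Matrix.diagonal_mul_diagonal]
  exact congrArg _ (funext fun x => mul_comm _ _)

theorem gateCZ_conjMaps (hij : i ≠ j) :
    ConjMaps ω (gateCZ i j) (xLabel i) (xLabel i + zLabel j) := by
  refine conjMaps_of_semiconjBy ?_
  rw [pauliOp_single_add (Pi.single_eq_of_ne hij _), ← gateX_eq_pauliOp, ← gateZ_eq_pauliOp]
  exact Subtype.ext (matCZ_matX hij)

theorem coe_pauliOp_zLabel (i : Fin n) :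
    (pauliOp ω (zLabel i)).1 =
      Matrix.diagonal fun x : Basis n => if x i = 1 then (-1 : ℂ) else 1 := by
  rw [← gateZ_eq_pauliOp, ← onQubit_matZ]
  rfl

theorem coe_pauliOp_zLabel_add (hv : v i = 0) {d : Basis n → ℂ}
    (hd : (pauliOp ω v).1 = Matrix.diagonal d) :
    (pauliOp ω (zLabel i + v)).1 =
      Matrix.diagonal fun x => (if x i = 1 then (-1 : ℂ) else 1) * d x := by
  rw [pauliOp_single_add hv, Submonoid.coe_mul, coe_pauliOp_zLabel, hd,
    Matrix.diagonal_mul_diagonal]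

theorem coe_pauliOp_zLabel_add_zLabel (hij : i ≠ j) :
    (pauliOp ω (zLabel i + zLabel j)).1 = Matrix.diagonal fun x : Basis n =>
      (if x i = 1 then (-1 : ℂ) else 1) * (if x j = 1 then -1 else 1) :=
  coe_pauliOp_zLabel_add (Pi.single_eq_of_ne hij _) (coe_pauliOp_zLabel j)

theorem matS_eq_involutionSqrt (ω : EighthRoot) : matS ω = involutionSqrt ω matZ := by
  have hZ : matZ = Matrix.diagonal ![1, -1] := by rw [Matrix.diagonal_fin_two]; rfl
  rw [hZ, involutionSqrt_diagonal, Matrix.diagonal_fin_two]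
  simp [involutionSqrt_one, involutionSqrt_neg_one, matS]

theorem onQubit_involutionSqrt (i : Fin n) (B : Matrix (Fin 2) (Fin 2) ℂ) :
    onQubit i (involutionSqrt ω B) = involutionSqrt ω (onQubit i B) := by
  rw [involutionSqrt, involutionSqrt, ← onQubit_one i, ← onQubit_smul, ← onQubit_smul]
  ext x y
  simp only [onQubit_apply, Matrix.add_apply]
  split_ifs
  · rfl
  · rw [add_zero]

theorem gateS_eq_sqrtPauli (i : Fin n) : gateS ω i = sqrtPauli ω (zLabel i) := by
  refine Subtype.ext ?_
  rw [coe_sqrtPauli, ← gateZ_eq_pauliOp]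
  change onQubit i (matS ω) = involutionSqrt ω (onQubit i matZ)
  rw [matS_eq_involutionSqrt, onQubit_involutionSqrt]

theorem gateCZ_mul_sqrtPauli (hij : i ≠ j) :
    gateCZ i j * sqrtPauli ω (zLabel i + zLabel j) =
      sqrtPauli ω (zLabel i) * sqrtPauli ω (zLabel j) := by
  refine Subtype.ext ?_
  change matCZ i j * (sqrtPauli ω (zLabel i + zLabel j)).1 = _
  simp only [Submonoid.coe_mul, coe_sqrtPauli, coe_pauliOp_zLabel,
    coe_pauliOp_zLabel_add_zLabel hij, involutionSqrt_diagonal, matCZ,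
    Matrix.diagonal_mul_diagonal]
  congr 1
  funext x
  by_cases hi : x i = 1 <;> by_cases hj : x j = 1 <;>
    simp [hi, hj, involutionSqrt_one, involutionSqrt_neg_one, ω.sq_mul_sq]

theorem sqrtPauli_zLabel_mul_three (hij : i ≠ j) (hik : i ≠ k) (hjk : j ≠ k) :
    sqrtPauli ω (zLabel i) * (sqrtPauli ω (zLabel j) * sqrtPauli ω (zLabel k) *
        sqrtPauli ω (zLabel i + (zLabel j + zLabel k))) =
      sqrtPauli ω (zLabel i + zLabel j) * sqrtPauli ω (zLabel i + zLabel k) *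
        sqrtPauli ω (zLabel j + zLabel k) := by
  have hi : (zLabel j + zLabel k) i = 0 := by
    rw [Pi.add_apply, zLabel, zLabel, Pi.single_eq_of_ne hij, Pi.single_eq_of_ne hik, add_zero]
  refine Subtype.ext ?_
  simp only [Submonoid.coe_mul, coe_sqrtPauli, coe_pauliOp_zLabel,
    coe_pauliOp_zLabel_add_zLabel hij, coe_pauliOp_zLabel_add_zLabel hik,
    coe_pauliOp_zLabel_add_zLabel hjk,
    coe_pauliOp_zLabel_add hi (coe_pauliOp_zLabel_add_zLabel hjk), involutionSqrt_diagonal,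
    Matrix.diagonal_mul_diagonal]
  congr 1
  funext x
  by_cases hi : x i = 1 <;> by_cases hj : x j = 1 <;> by_cases hk : x k = 1 <;>
    simp [hi, hj, hk, involutionSqrt_one, involutionSqrt_neg_one, ω.sq_mul_sq]

theorem matS_mul_matH_pow_three (ω : EighthRoot) :
    (matS ω * matH) ^ 3 = ((1 + (ω : ℂ) ^ 2) * (Real.sqrt 2 : ℂ)⁻¹) • 1 := by
  have hι := ω.sq_mul_sq
  have hSH : matS ω * matH =
      (Real.sqrt 2 : ℂ)⁻¹ • !![1, 1; (ω : ℂ) ^ 2, -(ω : ℂ) ^ 2] := by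
    simp [matS, matH, mul_comm]
  have hcube : !![1, 1; (ω : ℂ) ^ 2, -(ω : ℂ) ^ 2] ^ 3 = (2 * (1 + (ω : ℂ) ^ 2)) • 1 := by
    ext a b
    fin_cases a <;> fin_cases b <;>
      simp [pow_three, Matrix.mul_apply, Fin.sum_univ_two] <;> grind
  rw [hSH, smul_pow, hcube, smul_smul, pow_three, sqrt_two_sq]
  congr 1
  ring

theorem gateS_mul_gateH_pow_three_mem_phases (ω : EighthRoot) (i : Fin n) :
    (gateS ω i * gateH i) ^ 3 ∈ phases n := by
  refine ⟨(1 + (ω : ℂ) ^ 2) * (Real.sqrt 2 : ℂ)⁻¹, ?_⟩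
  rw [SubmonoidClass.coe_pow, Submonoid.coe_mul]
  change (onQubit i (matS ω) * onQubit i matH) ^ 3 = _
  rw [pow_three, onQubit_mul, onQubit_mul, onQubit_mul, ← pow_three, matS_mul_matH_pow_three,
    onQubit_smul, onQubit_one]

end

/-! ### Passing to the projective Clifford group -/

section

variable {ω : EighthRoot} {n : ℕ}

theorem toProj_mul (A B : Clifford ω n) : toProj A * toProj B = toProj (B * A) := rfl

theorem toProj_one : toProj (1 : Clifford ω n) = 1 := rfl

theorem toProj_surjective : Function.Surjective (toProj : Clifford ω n → ProjClifford ω n) :=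
  fun g => by
    obtain ⟨A, hA⟩ := QuotientGroup.mk_surjective g.unop
    exact ⟨A, by rw [toProj, hA, MulOpposite.op_unop]⟩

theorem toProj_eq_iff {A B : Clifford ω n} : toProj A = toProj B ↔ A.1⁻¹ * B.1 ∈ phases n := by
  rw [toProj, toProj, MulOpposite.op_inj, QuotientGroup.eq, Subgroup.mem_subgroupOf]
  rfl

theorem toProj_eq_one_iff {A : Clifford ω n} : toProj A = 1 ↔ A.1 ∈ phases n := by
  rw [← toProj_one, eq_comm, toProj_eq_iff, Subgroup.coe_one, inv_one, one_mul]

/-- The unitary operators that are Clifford operators with class in `G`. -/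
def unitaryPreimage (G : Subgroup (ProjClifford ω n)) : Subgroup (U n) where
  carrier := {A | ∃ hA : A ∈ Clifford ω n, toProj ⟨A, hA⟩ ∈ G}
  one_mem' := ⟨one_mem _, one_mem G⟩
  mul_mem' := fun ⟨hA, hAG⟩ ⟨hB, hBG⟩ => ⟨mul_mem hA hB, mul_mem hBG hAG⟩
  inv_mem' := fun ⟨hA, hAG⟩ => ⟨inv_mem hA, inv_mem hAG⟩

variable {G : Subgroup (ProjClifford ω n)}

theorem coe_mem_unitaryPreimage {A : Clifford ω n} : A.1 ∈ unitaryPreimage G ↔ toProj A ∈ G :=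
  ⟨fun ⟨_, hA⟩ => hA, fun hA => ⟨A.2, hA⟩⟩

theorem unitaryPreimage_le (G : Subgroup (ProjClifford ω n)) : unitaryPreimage G ≤ Clifford ω n :=
  fun _ hA => hA.1

theorem phases_le_unitaryPreimage (G : Subgroup (ProjClifford ω n)) :
    phases n ≤ unitaryPreimage G := fun A hA =>
  ⟨phases_le_clifford hA, toProj_eq_one_iff (A := ⟨A, phases_le_clifford hA⟩).mpr hA ▸ one_mem G⟩

theorem gateH_mem_unitaryPreimage {i : Fin n} : gateH i ∈ unitaryPreimage G ↔ h ω i ∈ G :=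
  coe_mem_unitaryPreimage (A := ⟨gateH i, gateH_mem ω i⟩)

theorem sqrtPauli_zLabel_mem_unitaryPreimage {i : Fin n} :
    sqrtPauli ω (zLabel i) ∈ unitaryPreimage G ↔ s ω i ∈ G := by
  rw [← gateS_eq_sqrtPauli]
  exact coe_mem_unitaryPreimage (A := ⟨gateS ω i, gateS_mem ω i⟩)

theorem ne_succ (i : Fin n) (hi : (i : ℕ) + 1 < n) : i ≠ ⟨i + 1, hi⟩ :=
  Fin.ne_of_val_ne (Nat.succ_ne_self _).symm

theorem gateCZ_mem_unitaryPreimage {i : Fin n} {hi : (i : ℕ) + 1 < n} :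
    gateCZ i ⟨i + 1, hi⟩ ∈ unitaryPreimage G ↔ lam ω i hi ∈ G :=
  coe_mem_unitaryPreimage (A := ⟨gateCZ i ⟨i + 1, hi⟩, gateCZ_mem ω (ne_succ i hi)⟩)

/-! ### The centralizer of a phase gate -/

theorem sympForm_zLabel_zLabel (i j : Fin n) : sympForm (zLabel i) (zLabel j) = 0 := by
  rcases eq_or_ne i j with rfl | hij
  · exact sympForm_self _
  · rw [sympForm_single, zLabel, Pi.single_eq_of_ne hij.symm]
    rfl

theorem sqrtPauli_zLabel_add_zLabel_mem_iff {K : Subgroup (U n)} {i j : Fin n} (hij : i ≠ j)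
    (hCZ : gateCZ i j ∈ K) (hi : sqrtPauli ω (zLabel i) ∈ K) :
    sqrtPauli ω (zLabel i + zLabel j) ∈ K ↔ sqrtPauli ω (zLabel j) ∈ K := by
  rw [← K.mul_mem_cancel_left hCZ, gateCZ_mul_sqrtPauli hij, K.mul_mem_cancel_left hi]

theorem transvectionClosed_sqrtPauli {K : Subgroup (U n)} (hK : phases n ≤ K) :
    TransvectionClosed {v | sqrtPauli ω v ∈ K} where
  zero_mem := Set.mem_ofPred_eq.mpr (sqrtPauli_zero (ω := ω) (n := n) ▸ one_mem K)
  add_mem _ _ hu hv huv := sqrtPauli_mem_of_conjMaps hK hu (sqrtPauli_conjMaps_add huv) hv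

theorem commute_pauliOp_of_conj_sqrtPauli {A P : U n} {v w : Label n} (hvw : sympForm v w = 1)
    (hP : P ∈ phases n) (hA : A * sqrtPauli ω v * A⁻¹ = sqrtPauli ω v * P) :
    Commute A (pauliOp ω v) := by
  have hsquare : A * pauliOp ω v * A⁻¹ = P * P * pauliOp ω v := by
    have hconj : A * pauliOp ω v * A⁻¹ = A * sqrtPauli ω v * A⁻¹ * (A * sqrtPauli ω v * A⁻¹) := by
      rw [← sqrtPauli_mul_self]
      group
    rw [hconj, hA, (commute_of_mem_phases hP _).mul_mul_mul_comm, sqrtPauli_mul_self,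
      (commute_of_mem_phases (mul_mem hP hP) _).eq]
  have hmaps : ConjMaps ω A v v := by
    obtain ⟨c, hc⟩ := mul_mem hP hP
    refine conjMaps_iff_exists_smul.mpr ⟨c, ?_⟩
    rw [← Submonoid.coe_mul, mul_inv_eq_iff_eq_mul.mp hsquare, Submonoid.coe_mul,
      Submonoid.coe_mul, hc, smul_mul_assoc, one_mul, smul_mul_assoc]
  rcases conj_sqrtPauli hmaps with hfix | hinv
  · have hcomm : Commute A (sqrtPauli ω v) := mul_inv_eq_iff_eq_mul.mp hfix
    exact sqrtPauli_mul_self (ω := ω) v ▸ hcomm.mul_right hcomm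
  · have hphase : pauliOp ω v ∈ phases n := by
      have heq : pauliOp ω v = gateScalar ω n * P⁻¹ := by
        rw [hA, eq_inv_mul_iff_mul_eq, ← mul_assoc, sqrtPauli_mul_self] at hinv
        exact eq_mul_inv_of_mul_eq hinv
      exact heq ▸ mul_mem (gateScalar_mem_phases ω n) (inv_mem hP)
    exact absurd (hvw.symm.trans (commute_pauliOp_iff.mp (commute_of_mem_phases hphase _)))
      one_ne_zero

theorem mem_unitaryPreimage_centralizer {A : U n} {i : Fin n} :
    A ∈ unitaryPreimage (Subgroup.centralizer {s ω i}) ↔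
      A ∈ Clifford ω n ∧ Commute A (pauliOp ω (zLabel i)) := by
  refine ⟨fun ⟨hA, hmem⟩ => ⟨hA, ?_⟩, fun ⟨hA, hcomm⟩ => ⟨hA, ?_⟩⟩
  · rw [Subgroup.mem_centralizer_singleton_iff, s, toProj_mul, toProj_mul, toProj_eq_iff] at hmem
    refine Commute.inv_left_iff.mp
      (commute_pauliOp_of_conj_sqrtPauli (sympForm_zLabel_xLabel i) (inv_mem hmem) ?_)
    simp only [Subgroup.coe_mul, ← gateS_eq_sqrtPauli]
    group
  · rw [Subgroup.mem_centralizer_singleton_iff, s, toProj_mul, toProj_mul]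
    congr 1
    refine Subtype.ext ?_
    simp only [Subgroup.coe_mul, gateS_eq_sqrtPauli]
    exact (semiconjBy_sqrtPauli hcomm).symm

theorem centralizer_le [NeZero n]
    (hG : ∀ A ∈ Clifford ω n, Commute A (pauliOp ω (zLabel 0)) → A ∈ unitaryPreimage G) :
    Subgroup.centralizer {s ω (0 : Fin n)} ≤ G := by
  intro g hg
  obtain ⟨A, rfl⟩ := toProj_surjective g
  obtain ⟨hA, hcomm⟩ := mem_unitaryPreimage_centralizer.mp (coe_mem_unitaryPreimage.mpr hg)
  exact coe_mem_unitaryPreimage.mp (hG A hA hcomm)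

theorem h_mem_centralizer {i j : Fin n} (hij : i ≠ j) : h ω i ∈ Subgroup.centralizer {s ω j} :=
  gateH_mem_unitaryPreimage.mp (mem_unitaryPreimage_centralizer.mpr
    ⟨gateH_mem ω i, commute_gateH_pauliOp (Pi.single_eq_of_ne hij _)⟩)

theorem s_mem_centralizer (i j : Fin n) : s ω i ∈ Subgroup.centralizer {s ω j} :=
  sqrtPauli_zLabel_mem_unitaryPreimage.mp (mem_unitaryPreimage_centralizer.mpr
    ⟨sqrtPauli_mem_clifford _, commute_sqrtPauli_pauliOp (sympForm_zLabel_zLabel i j)⟩)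

theorem lam_mem_centralizer (i j : Fin n) (hi : (i : ℕ) + 1 < n) :
    lam ω i hi ∈ Subgroup.centralizer {s ω j} :=
  gateCZ_mem_unitaryPreimage.mp (mem_unitaryPreimage_centralizer.mpr
    ⟨gateCZ_mem ω (ne_succ i hi), commute_gateCZ_pauliOp_zLabel _ _ _⟩)

theorem sqrtPauli_mem_of_tailGates_subset (hG : tailGates ω n ⊆ G) {v : Label n}
    (hv : v ∈ supportedFrom n 1) : sqrtPauli ω v ∈ unitaryPreimage G := by
  have hphases := phases_le_unitaryPreimage G
  have hz (i : Fin n) (hi : 1 ≤ (i : ℕ)) : sqrtPauli ω (zLabel i) ∈ unitaryPreimage G :=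
    sqrtPauli_zLabel_mem_unitaryPreimage.mpr (hG ⟨i, by omega, Or.inr (Or.inl rfl)⟩)
  refine (transvectionClosed_sqrtPauli hphases).mem_of_mem_supportedFrom (fun i hi => ?_) hz
    (fun i hi hi₁ => ?_) hv
  · exact sqrtPauli_mem_of_conjMaps hphases
      (gateH_mem_unitaryPreimage.mpr (hG ⟨i, by omega, Or.inl rfl⟩))
      (conjMaps_of_semiconjBy (semiconjBy_gateH_z i)) (hz i hi)
  · have hCZ : gateCZ i ⟨i + 1, hi⟩ ∈ unitaryPreimage G :=
      gateCZ_mem_unitaryPreimage.mpr (hG ⟨i, by omega, Or.inr (Or.inr ⟨hi, rfl⟩)⟩)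
    exact (sqrtPauli_zLabel_add_zLabel_mem_iff (ne_succ i hi) hCZ (hz i hi₁)).mpr (hz _ (by simp))

theorem centralizer_le_of_gates [NeZero n] (htail : tailGates ω n ⊆ G) (hs : s ω 0 ∈ G)
    (ht : 2 ≤ n → ∃ t ∈ supportedFrom n 1, t ≠ 0 ∧
      sqrtPauli ω (zLabel 0 + t) ∈ unitaryPreimage G) :
    Subgroup.centralizer {s ω (0 : Fin n)} ≤ G :=
  centralizer_le fun _ hAC hA =>
    mem_of_commute_zLabel_zero (phases_le_unitaryPreimage G) (unitaryPreimage_le G)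
      (fun _ hv => (transvectionClosed_sqrtPauli
        (phases_le_unitaryPreimage G)).mem_of_sympForm_zLabel_zero
          (sqrtPauli_zLabel_mem_unitaryPreimage.mpr hs)
          (fun _ => sqrtPauli_mem_of_tailGates_subset htail) ht hv) hAC hA

end

/-! ### Generators of the centralizer -/

section

variable {ω : EighthRoot} {n : ℕ} {i j : Fin n} {v w : Label n}

theorem commute_sqrtPauli (hvw : sympForm v w = 0) :
    Commute (sqrtPauli ω v) (sqrtPauli ω w) :=
  semiconjBy_sqrtPauli (commute_sqrtPauli_pauliOp hvw)

theorem semiconjBy_gateH_zLabel_add (hv : v i = 0) :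
    SemiconjBy (gateH i) (pauliOp ω (zLabel i + v)) (pauliOp ω (xLabel i + v)) := by
  rw [pauliOp_single_add hv, pauliOp_single_add hv]
  exact (semiconjBy_gateH_z i).mul_right (commute_gateH_pauliOp hv)

theorem conj_mul_inv_of_commute {G : Type*} [Group G] {a b c : G} (hab : Commute a b)
    (hac : Commute a c) :
    a * b⁻¹ * (a * c⁻¹) * (a * b⁻¹)⁻¹ = a * (b⁻¹ * c * b)⁻¹ :=
  calc a * b⁻¹ * (a * c⁻¹) * (a * b⁻¹)⁻¹
      = b⁻¹ * a * (a * c⁻¹) * (b⁻¹ * a)⁻¹ := by rw [hab.inv_right.eq]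
    _ = b⁻¹ * (a * (a * c⁻¹) * a⁻¹) * b := by group
    _ = b⁻¹ * (a * c⁻¹) * b := by
        rw [((Commute.refl a).mul_right hac.inv_right).eq, mul_inv_cancel_right]
    _ = b⁻¹ * a * (c⁻¹ * b) := by group
    _ = a * (b⁻¹ * c * b)⁻¹ := by rw [← hab.inv_right.eq]; group

/-- With `R v` the square root of the Pauli operator with label `v`, the subgroup contains
`a = R (z j) * (R (z i + z j))⁻¹`. Its conjugate by the Hadamard gate on qubit `i` is
`R (z j) * (R (x i + z j))⁻¹`, and conjugating that by `a` trades the label `x i + z j` for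
`z i + x i`. -/
theorem sqrtPauli_zLabel_mem_of_gateCZ_mem {K : Subgroup (U n)} (hK : phases n ≤ K)
    (hij : i ≠ j) (hH : gateH i ∈ K) (hCZ : gateCZ i j ∈ K) (hi : sqrtPauli ω (zLabel i) ∈ K) :
    sqrtPauli ω (zLabel j) ∈ K := by
  have hji : zLabel j i = 0 := Pi.single_eq_of_ne hij _
  have hx : sqrtPauli ω (xLabel i) ∈ K :=
    sqrtPauli_mem_of_conjMaps hK hH (conjMaps_of_semiconjBy (semiconjBy_gateH_z i)) hi
  have hy : sqrtPauli ω (zLabel i + xLabel i) ∈ K :=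
    (transvectionClosed_sqrtPauli hK).add_mem hi hx (sympForm_zLabel_xLabel i)
  have hzz : Commute (sqrtPauli ω (zLabel j)) (sqrtPauli ω (zLabel i + zLabel j)) :=
    commute_sqrtPauli (by
      rw [sympForm_add_right, sympForm_self, sympForm_zLabel_zLabel, add_zero])
  have hxz : Commute (sqrtPauli ω (zLabel j)) (sqrtPauli ω (xLabel i + zLabel j)) :=
    commute_sqrtPauli (by
      rw [sympForm_add_right, sympForm_self, sympForm_single, hji]
      rfl)
  have ha : sqrtPauli ω (zLabel j) * (sqrtPauli ω (zLabel i + zLabel j))⁻¹ ∈ K := by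
    rwa [← K.mul_mem_cancel_left hi, ← mul_assoc, ← gateCZ_mul_sqrtPauli hij,
      mul_inv_cancel_right]
  have hconj := ((semiconjBy_sqrtPauli (ω := ω) (commute_gateH_pauliOp hji)).mul_right
    (semiconjBy_sqrtPauli (ω := ω) (semiconjBy_gateH_zLabel_add hji)).inv_right).eq
  have ha' : sqrtPauli ω (zLabel j) * (sqrtPauli ω (xLabel i + zLabel j))⁻¹ ∈ K :=
    mul_inv_eq_iff_eq_mul.mpr hconj ▸ mul_mem (mul_mem hH ha) (inv_mem hH)
  have hmaps : ConjMaps ω (sqrtPauli ω (zLabel i + zLabel j))⁻¹ (xLabel i + zLabel j)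
      (zLabel i + xLabel i) := by
    have hform : sympForm (zLabel i + xLabel i) (xLabel i + zLabel j) = 1 := by
      rw [sympForm_add_left, sympForm_add_right, sympForm_add_right, sympForm_zLabel_xLabel,
        sympForm_zLabel_zLabel, sympForm_self, sympForm_comm, sympForm_single, hji]
      rfl
    have hadd : zLabel i + xLabel i + (xLabel i + zLabel j) = zLabel i + zLabel j := by
      rw [add_assoc, add_add_cancel_label]
    exact hadd ▸ (sqrtPauli_add_conjMaps hform).inv
  have hmem := mul_mem (mul_mem ha ha') (inv_mem ha)
  rw [conj_mul_inv_of_commute hzz hxz] at hmem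
  refine (K.mul_mem_cancel_right (inv_mem ?_)).mp hmem
  simpa only [inv_inv] using (conj_sqrtPauli_mem_iff hK hmaps).mpr hy

end

section

variable {ω : EighthRoot} {n : ℕ}

theorem centralizer_one :
    Subgroup.centralizer {s ω (0 : Fin 1)} = Subgroup.closure {s ω (0 : Fin 1)} := by
  refine le_antisymm (centralizer_le_of_gates ?_ (Subgroup.mem_closure_singleton_self _)
    fun h₂ => absurd h₂ (by norm_num)) ?_
  · rintro g ⟨i, hi, -⟩
    exact absurd (Fin.val_eq_zero i) hi
  · rw [Subgroup.closure_le, Set.singleton_subset_iff]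
    exact s_mem_centralizer 0 0

theorem zLabel_mem_supportedFrom_one {i : Fin n} (hi : (i : ℕ) ≠ 0) :
    zLabel i ∈ supportedFrom n 1 :=
  single_mem_supportedFrom (Nat.one_le_iff_ne_zero.mpr hi) _

theorem s_zero_mem_of_lam_zero_mem {G : Subgroup (ProjClifford ω (n + 2))}
    (htail : tailGates ω (n + 2) ⊆ G) (hlam : lam ω 0 (by simp) ∈ G) : s ω 0 ∈ G := by
  have hCZ : gateCZ 1 0 ∈ unitaryPreimage G := by
    rw [show gateCZ 1 0 = gateCZ 0 1 from Subtype.ext (matCZ_comm 1 0)]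
    exact gateCZ_mem_unitaryPreimage.mpr hlam
  exact sqrtPauli_zLabel_mem_unitaryPreimage.mp (sqrtPauli_zLabel_mem_of_gateCZ_mem
    (phases_le_unitaryPreimage G) one_ne_zero
    (gateH_mem_unitaryPreimage.mpr (htail ⟨1, by simp, Or.inl rfl⟩)) hCZ
    (sqrtPauli_mem_of_tailGates_subset htail (zLabel_mem_supportedFrom_one (by simp))))

theorem centralizer_eq_closure {S : Set (ProjClifford ω (n + 2))}
    (htail : tailGates ω (n + 2) ⊆ S) (hlam : lam ω 0 (by simp) ∈ S)
    (hS : S ⊆ Subgroup.centralizer {s ω (0 : Fin (n + 2))}) :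
    Subgroup.centralizer {s ω (0 : Fin (n + 2))} = Subgroup.closure S := by
  have hle := Subgroup.subset_closure (k := S)
  have htail' := htail.trans hle
  have hs : s ω 0 ∈ Subgroup.closure S := s_zero_mem_of_lam_zero_mem htail' (hle hlam)
  have hz : sqrtPauli ω (zLabel 1) ∈ unitaryPreimage (Subgroup.closure S) :=
    sqrtPauli_mem_of_tailGates_subset htail' (zLabel_mem_supportedFrom_one (by simp))
  refine le_antisymm (centralizer_le_of_gates htail' hs fun _ =>
    ⟨zLabel 1, zLabel_mem_supportedFrom_one (by simp), zLabel_ne_zero 1, ?_⟩)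
    ((Subgroup.closure_le _).mpr hS)
  exact (sqrtPauli_zLabel_add_zLabel_mem_iff (by simp) (gateCZ_mem_unitaryPreimage.mpr (hle hlam))
    (sqrtPauli_zLabel_mem_unitaryPreimage.mpr hs)).mpr hz

/-- The gates listed in the theorem as generators of the centralizer of `s ω 0`. -/
def centralizerGates (ω : EighthRoot) (n : ℕ) [NeZero n] : Set (ProjClifford ω n) :=
  {g | ∃ i : Fin n, i ≠ 0 ∧ g = h ω i} ∪ {g | ∃ i : Fin n, g = s ω i} ∪
    {g | ∃ (i : Fin n) (hi : (i : ℕ) + 1 < n), g = lam ω i hi}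

/-- The gates of `centralizerGates`, with the phase gate on the first qubit left out. -/
def reducedCentralizerGates (ω : EighthRoot) (n : ℕ) [NeZero n] : Set (ProjClifford ω n) :=
  {g | ∃ i : Fin n, i ≠ 0 ∧ g = h ω i} ∪ {g | ∃ i : Fin n, i ≠ 0 ∧ g = s ω i} ∪
    {g | ∃ (i : Fin n) (hi : (i : ℕ) + 1 < n), g = lam ω i hi}

theorem tailGates_subset_reducedCentralizerGates [NeZero n] :
    tailGates ω n ⊆ reducedCentralizerGates ω n := by
  rintro g ⟨i, hi, rfl | rfl | ⟨hi', rfl⟩⟩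
  · exact Or.inl (Or.inl ⟨i, Fin.val_ne_zero_iff.mp hi, rfl⟩)
  · exact Or.inl (Or.inr ⟨i, Fin.val_ne_zero_iff.mp hi, rfl⟩)
  · exact Or.inr ⟨i, hi', rfl⟩

theorem reducedCentralizerGates_subset [NeZero n] :
    reducedCentralizerGates ω n ⊆ centralizerGates ω n :=
  Set.union_subset_union_left _ (Set.union_subset_union_right _ fun _ ⟨i, _, hg⟩ => ⟨i, hg⟩)

theorem centralizerGates_subset_centralizer [NeZero n] :
    centralizerGates ω n ⊆ Subgroup.centralizer {s ω (0 : Fin n)} := by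
  rintro g ((⟨i, hi, rfl⟩ | ⟨i, rfl⟩) | ⟨i, hi, rfl⟩)
  · exact h_mem_centralizer hi
  · exact s_mem_centralizer i 0
  · exact lam_mem_centralizer i 0 hi

theorem tailGates_subset_centralizer [NeZero n] :
    tailGates ω n ⊆ Subgroup.centralizer {s ω (0 : Fin n)} :=
  tailGates_subset_reducedCentralizerGates.trans
    (reducedCentralizerGates_subset.trans centralizerGates_subset_centralizer)

theorem centralizer_eq_closure_reducedCentralizerGates (ω : EighthRoot) (n : ℕ) :
    Subgroup.centralizer {s ω (0 : Fin (n + 2))} =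
      Subgroup.closure (reducedCentralizerGates ω (n + 2)) :=
  centralizer_eq_closure tailGates_subset_reducedCentralizerGates (Or.inr ⟨0, by simp, rfl⟩)
    (reducedCentralizerGates_subset.trans centralizerGates_subset_centralizer)

theorem centralizer_eq_closure_centralizerGates (ω : EighthRoot) (n : ℕ) :
    Subgroup.centralizer {s ω (0 : Fin (n + 2))} =
      Subgroup.closure (centralizerGates ω (n + 2)) :=
  centralizer_eq_closure
    (tailGates_subset_reducedCentralizerGates.trans reducedCentralizerGates_subset)
    (Or.inr ⟨0, by simp, rfl⟩) centralizerGates_subset_centralizer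

end

/-! ### The square root of the first `Y` operator -/

section

variable {ω : EighthRoot} {n : ℕ} {i j : Fin n}

theorem toProj_pow (A : Clifford ω n) (m : ℕ) : toProj A ^ m = toProj (A ^ m) := rfl

theorem commute_toProj {A B : Clifford ω n} (hAB : Commute A.1 B.1) :
    Commute (toProj A) (toProj B) :=
  congrArg toProj (Subtype.ext hAB.symm.eq)

theorem h_mul_h (i : Fin n) : h ω i * h ω i = 1 := by
  rw [h, toProj_mul, toProj_eq_one_iff, Subgroup.coe_mul, gateH_mul_self]
  exact one_mem _

theorem inv_h (i : Fin n) : (h ω i)⁻¹ = h ω i :=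
  inv_eq_of_mul_eq_one_left (h_mul_h i)

theorem s_eq (ω : EighthRoot) (i : Fin n) :
    s ω i = toProj ⟨sqrtPauli ω (zLabel i), sqrtPauli_mem_clifford _⟩ :=
  congrArg toProj (Subtype.ext (gateS_eq_sqrtPauli i))

theorem s_pow_four (i : Fin n) : s ω i ^ 4 = 1 := by
  rw [s_eq, toProj_pow, toProj_eq_one_iff, Subgroup.coe_pow, sqrtPauli_pow_four]
  exact one_mem _

theorem inv_s_sq (i : Fin n) : (s ω i ^ 2)⁻¹ = s ω i ^ 2 := by
  rw [inv_eq_iff_mul_eq_one, ← pow_add, s_pow_four]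

theorem s_mul_s_ne_one (i : Fin n) : s ω i * s ω i ≠ 1 := by
  rw [s_eq, toProj_mul, Ne, toProj_eq_one_iff, Subgroup.coe_mul, sqrtPauli_mul_self]
  intro hphase
  exact one_ne_zero ((sympForm_zLabel_xLabel i).symm.trans
    (commute_pauliOp_iff.mp (commute_of_mem_phases hphase (pauliOp ω (xLabel i)))))

theorem h_mul_s_pow_three (i : Fin n) : (h ω i * s ω i) ^ 3 = 1 := by
  rw [h, s, toProj_mul, toProj_pow, toProj_eq_one_iff]
  exact gateS_mul_gateH_pow_three_mem_phases ω i

theorem inv_h_mul_s (i : Fin n) : (h ω i * s ω i)⁻¹ = s ω i ^ 3 * h ω i := by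
  have hs : s ω i ^ 3 * s ω i = 1 := by rw [← pow_succ, s_pow_four]
  rw [mul_inv_rev, inv_h, inv_eq_of_mul_eq_one_left hs]

theorem commute_gateCZ_of_commute_pauliOp {A : U n} (hij : i ≠ j)
    (hi : Commute A (pauliOp ω (zLabel i))) (hj : Commute A (pauliOp ω (zLabel j))) :
    Commute A (gateCZ i j) := by
  have hadd : Commute A (pauliOp ω (zLabel i + zLabel j)) :=
    pauliOp_single_add (Pi.single_eq_of_ne hij (0, 1)) (0, 1) ▸ hi.mul_right hj
  rw [eq_mul_inv_of_mul_eq (gateCZ_mul_sqrtPauli (ω := ω) hij)]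
  exact ((semiconjBy_sqrtPauli hi).mul_right (semiconjBy_sqrtPauli hj)).mul_right
    (semiconjBy_sqrtPauli hadd).inv_right

theorem commute_h_of_mem_tailGates [NeZero n] {g : ProjClifford ω n} (hg : g ∈ tailGates ω n) :
    Commute (h ω 0) g := by
  obtain ⟨i, hi, hg⟩ := hg
  have h0i : 0 ≠ i := (Fin.val_ne_zero_iff.mp hi).symm
  rcases hg with rfl | rfl | ⟨hi', rfl⟩
  · exact commute_toProj (Subtype.ext (onQubit_comm h0i _ _))
  · exact Subgroup.mem_centralizer_singleton_iff.mp (h_mem_centralizer h0i)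
  · exact commute_toProj (commute_gateCZ_of_commute_pauliOp (ne_succ i hi')
      (commute_gateH_pauliOp (ω := ω) (Pi.single_eq_of_ne h0i _))
      (commute_gateH_pauliOp (Pi.single_eq_of_ne (Fin.ne_of_val_ne (by simp)) _)))

theorem commute_h_mul_s_of_mem_tailGates [NeZero n] {g : ProjClifford ω n}
    (hg : g ∈ tailGates ω n) : Commute (h ω (0 : Fin n) * s ω 0) g :=
  (commute_h_of_mem_tailGates hg).mul_left
    (Subgroup.mem_centralizer_singleton_iff.mp (tailGates_subset_centralizer hg)).symm

/-- The element `s₁³h₁s₁h₁s₁`, the class of a square root of the first Pauli `Y` operator. -/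
def sqrtY (ω : EighthRoot) (n : ℕ) [NeZero n] : ProjClifford ω n :=
  s ω 0 ^ 3 * h ω 0 * s ω 0 * h ω 0 * s ω 0

variable [NeZero n]

theorem sqrtY_eq : sqrtY ω n = s ω 0 ^ 2 * h ω 0 :=
  calc sqrtY ω n = s ω 0 ^ 2 * (h ω (0 : Fin n))⁻¹ * (h ω 0 * s ω 0) ^ 3 := by
        rw [sqrtY, pow_three (h ω 0 * s ω 0)]
        group
    _ = s ω 0 ^ 2 * h ω 0 := by rw [h_mul_s_pow_three, inv_h, mul_one]

theorem conj_sqrtY :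
    (h ω (0 : Fin n) * s ω 0) * sqrtY ω n * (h ω (0 : Fin n) * s ω 0)⁻¹ = s ω 0 :=
  calc (h ω (0 : Fin n) * s ω 0) * sqrtY ω n * (h ω (0 : Fin n) * s ω 0)⁻¹
      = h ω 0 * s ω 0 ^ 4 * h ω 0 * s ω 0 := by rw [sqrtY]; group
    _ = s ω 0 := by rw [s_pow_four, mul_one, h_mul_h, one_mul]

theorem inv_sqrtY : (sqrtY ω n)⁻¹ = h ω 0 * s ω 0 ^ 2 := by
  rw [sqrtY_eq, mul_inv_rev, inv_s_sq, inv_h]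

theorem semiconjBy_h_sqrtY : SemiconjBy (h ω (0 : Fin n)) (sqrtY ω n) (sqrtY ω n)⁻¹ := by
  rw [SemiconjBy, inv_sqrtY, sqrtY_eq, mul_assoc]

theorem sqrtY_mul_sqrtY_ne_one : sqrtY ω n * sqrtY ω n ≠ 1 := fun hsq =>
  s_mul_s_ne_one (ω := ω) (0 : Fin n) (by
    rw [← conj_sqrtY, conj_mul, hsq, mul_one, mul_inv_cancel])

end

/-! ### The element `M` -/

section

variable {ω : EighthRoot} {n : ℕ} {i j : Fin n} {v w : Label n}

theorem gateS_mul_gateH_conjMaps (hv : v i = 0) :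
    ConjMaps ω (gateS ω i * gateH i) (zLabel i + v) (zLabel i + (xLabel i + v)) := by
  have hform : sympForm (zLabel i) (xLabel i + v) = 1 := by
    rw [sympForm_add_right, sympForm_zLabel_xLabel, sympForm_single_left, hv]
    rfl
  have hH : ConjMaps ω (gateH i) (zLabel i + v) (xLabel i + v) :=
    conjMaps_of_semiconjBy (semiconjBy_gateH_zLabel_add hv)
  have hS : ConjMaps ω (gateS ω i) (xLabel i + v) (zLabel i + (xLabel i + v)) :=
    gateS_eq_sqrtPauli (ω := ω) i ▸ sqrtPauli_conjMaps_add hform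
  exact hS.mul hH

theorem gateH_mul_gateCZ_mul_gateH_conjMaps (hij : i ≠ j) :
    ConjMaps ω (gateH j * (gateCZ i j * gateH j)) (zLabel i + xLabel i)
      (xLabel j + (zLabel i + xLabel i)) := by
  have hj : (zLabel i + xLabel i) j = 0 := by
    rw [← Pi.single_add, Pi.single_eq_of_ne hij.symm]
  have hCZ : ConjMaps ω (gateCZ i j) (zLabel i + xLabel i) (zLabel j + (zLabel i + xLabel i)) := by
    rw [add_comm (zLabel j), add_assoc]
    exact (conjMaps_of_commute (commute_gateCZ_pauliOp_zLabel i j i)).add (gateCZ_conjMaps hij)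
  have hH : ConjMaps ω (gateH j) (zLabel i + xLabel i) (zLabel i + xLabel i) :=
    conjMaps_of_commute (commute_gateH_pauliOp hj)
  have hH' : ConjMaps ω (gateH j) (zLabel j + (zLabel i + xLabel i))
      (xLabel j + (zLabel i + xLabel i)) :=
    conjMaps_of_semiconjBy (semiconjBy_gateH_zLabel_add hj)
  exact hH'.mul (hCZ.mul hH)

theorem conj_s_mem_iff {G : Subgroup (ProjClifford ω n)} {A : Clifford ω n}
    (hA : ConjMaps ω A.1 (zLabel i) w) :
    (toProj A)⁻¹ * s ω i * toProj A ∈ G ↔ sqrtPauli ω w ∈ unitaryPreimage G := by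
  rw [← conj_sqrtPauli_mem_iff (phases_le_unitaryPreimage G) hA, s_eq, mul_assoc A.1]
  exact (coe_mem_unitaryPreimage
    (A := A * (⟨sqrtPauli ω (zLabel i), sqrtPauli_mem_clifford _⟩ * A⁻¹))).symm

theorem conj_gateS_mul_gateH_conjMaps (hij : i ≠ j) :
    ConjMaps ω ((gateS ω i * gateH i)⁻¹ * (gateH j * (gateCZ i j * gateH j) *
      (gateS ω i * gateH i))) (zLabel i) (zLabel i + xLabel j) := by
  have hC : ConjMaps ω (gateS ω i * gateH i) (zLabel i) (zLabel i + xLabel i) := by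
    simpa only [add_zero] using gateS_mul_gateH_conjMaps (v := 0) rfl
  have hC' : ConjMaps ω (gateS ω i * gateH i)⁻¹ (xLabel j + (zLabel i + xLabel i))
      (zLabel i + xLabel j) := by
    rw [add_comm (xLabel j), add_assoc]
    exact (gateS_mul_gateH_conjMaps (Pi.single_eq_of_ne hij _)).inv
  exact hC'.mul ((gateH_mul_gateCZ_mul_gateH_conjMaps hij).mul hC)

theorem lam_mul_lam (i : Fin n) (hi : (i : ℕ) + 1 < n) : lam ω i hi * lam ω i hi = 1 := by
  rw [lam, toProj_mul, toProj_eq_one_iff, Subgroup.coe_mul,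
    mul_eq_one_iff_eq_inv.mpr (inv_gateCZ i _).symm]
  exact one_mem _

theorem M_eq (ω : EighthRoot) (n : ℕ) :
    M ω n = h ω (1 : Fin (n + 2)) * s ω 1 ^ 2 * h ω 1 *
      ((h ω (1 : Fin (n + 2)) * lam ω 0 (by simp) * h ω 1)⁻¹ *
        (sqrtY ω (n + 2))⁻¹ * (h ω 1 * lam ω 0 (by simp) * h ω 1)) := by
  have hlam : (lam ω (0 : Fin (n + 2)) (by simp))⁻¹ = lam ω 0 (by simp) :=
    inv_eq_of_mul_eq_one_left (lam_mul_lam 0 _)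
  have hcomm : Commute (lam ω 0 (by simp)) (s ω (1 : Fin (n + 2)) ^ 2) :=
    Commute.pow_right (Subgroup.mem_centralizer_singleton_iff.mp (lam_mem_centralizer 0 1 _)) 2
  calc M ω n
      = h ω 1 * (lam ω 0 (by simp) * s ω 1 ^ 2) * h ω 1 * (h ω 0 * s ω 0 ^ 2) *
          (h ω 1 * lam ω 0 (by simp) * h ω 1) := by rw [M]; simp only [mul_assoc]
    _ = h ω 1 * (s ω 1 ^ 2 * (lam ω (0 : Fin (n + 2)) (by simp))⁻¹) *
          (h ω (1 : Fin (n + 2)))⁻¹ * (sqrtY ω (n + 2))⁻¹ *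
          (h ω 1 * lam ω 0 (by simp) * h ω 1) := by rw [hcomm.eq, hlam, inv_h, inv_sqrtY]
    _ = _ := by group

/-- Up to a Pauli operator on the second qubit, conjugation by `h₁s₁` takes `M` to the inverse of
the square root of `Z ⊗ X`. -/
theorem conj_M_mem_iff {G : Subgroup (ProjClifford ω (n + 2))}
    (hG : tailGates ω (n + 2) ⊆ G) :
    (h ω 0 * s ω 0) * M ω n * (h ω (0 : Fin (n + 2)) * s ω 0)⁻¹ ∈ G ↔
      sqrtPauli ω (zLabel 0 + xLabel 1) ∈ unitaryPreimage G := by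
  set c := h ω (0 : Fin (n + 2)) * s ω 0
  set d := h ω (1 : Fin (n + 2)) * lam ω 0 (by simp) * h ω 1 with hd
  have hh : h ω 1 ∈ tailGates ω (n + 2) := ⟨1, by simp, Or.inl rfl⟩
  have hs : s ω 1 ∈ tailGates ω (n + 2) := ⟨1, by simp, Or.inr (Or.inl rfl)⟩
  set x := h ω (1 : Fin (n + 2)) * s ω 1 ^ 2 * h ω 1 with hx
  have hxG : x ∈ G := mul_mem (mul_mem (hG hh) (pow_mem (hG hs) 2)) (hG hh)
  have hcx : Commute c x :=
    ((commute_h_mul_s_of_mem_tailGates hh).mul_right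
      ((commute_h_mul_s_of_mem_tailGates hs).pow_right 2)).mul_right
        (commute_h_mul_s_of_mem_tailGates hh)
  have hconj : c * M ω n * c⁻¹ = x * ((c * d * c⁻¹)⁻¹ * s ω 0 * (c * d * c⁻¹))⁻¹ :=
    calc c * M ω n * c⁻¹
        = c * x * c⁻¹ * ((c * d * c⁻¹)⁻¹ * (c * sqrtY ω (n + 2) * c⁻¹) * (c * d * c⁻¹))⁻¹ := by
          rw [M_eq, ← hd, ← hx]; group
      _ = x * ((c * d * c⁻¹)⁻¹ * s ω 0 * (c * d * c⁻¹))⁻¹ := by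
          rw [hcx.mul_inv_cancel, conj_sqrtY]
  let C : Clifford ω (n + 2) := ⟨gateS ω 0, gateS_mem ω 0⟩ * ⟨gateH 0, gateH_mem ω 0⟩
  let D : Clifford ω (n + 2) := ⟨gateH 1, gateH_mem ω 1⟩ *
    (⟨gateCZ 0 1, gateCZ_mem ω (by simp)⟩ * ⟨gateH 1, gateH_mem ω 1⟩)
  have htoProj : c * d * c⁻¹ = toProj (C⁻¹ * (D * C)) := rfl
  rw [hconj, mul_mem_cancel_left hxG, inv_mem_iff, htoProj]
  exact conj_s_mem_iff (conj_gateS_mul_gateH_conjMaps (by simp))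

theorem conj_M_mem_centralizer :
    (h ω 0 * s ω 0) * M ω n * (h ω (0 : Fin (n + 2)) * s ω 0)⁻¹ ∈
      Subgroup.centralizer {s ω (0 : Fin (n + 2))} := by
  have hx : xLabel 1 (0 : Fin (n + 2)) = 0 := Pi.single_eq_of_ne (by simp) _
  refine (conj_M_mem_iff tailGates_subset_centralizer).mpr (mem_unitaryPreimage_centralizer.mpr
    ⟨sqrtPauli_mem_clifford _, commute_sqrtPauli_pauliOp ?_⟩)
  rw [sympForm_add_left, sympForm_self, zero_add, sympForm_single, hx]
  rfl

end

/-! ### The subgroup `F` -/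

section

variable {ω : EighthRoot} {n : ℕ}

theorem tailGates_two : tailGates ω 2 = {h ω 1, s ω 1} := by
  ext g
  constructor
  · rintro ⟨i, hi, hg⟩
    obtain rfl : i = 1 := by omega
    rcases hg with rfl | rfl | ⟨hi', rfl⟩
    · exact Or.inl rfl
    · exact Or.inr rfl
    · exact absurd hi' (by decide)
  · rintro (rfl | rfl)
    · exact ⟨1, by simp, Or.inl rfl⟩
    · exact ⟨1, by simp, Or.inr (Or.inl rfl)⟩

theorem F_two : F ω 2 = Subgroup.closure ({M ω 0, sqrtY ω 2} ∪ tailGates ω 2) := by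
  rw [tailGates_two, Set.union_comm, Set.insert_union, Set.singleton_union,
    Set.pair_comm (M ω 0)]
  rfl

theorem tailGates_subset_F : tailGates ω (n + 2) ⊆ F ω (n + 2) := by
  match n with
  | 0 => rw [F_two]; exact Set.subset_union_right.trans Subgroup.subset_closure
  | n + 1 => exact Set.subset_union_right.trans Subgroup.subset_closure

theorem M_mem_F : M ω n ∈ F ω (n + 2) := by
  match n with
  | 0 => rw [F_two]; exact Subgroup.subset_closure (Or.inl (Or.inl rfl))
  | n + 1 => exact Subgroup.subset_closure (Or.inl rfl)

theorem sqrtY_mem_F_two : sqrtY ω 2 ∈ F ω 2 := by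
  rw [F_two]
  exact Subgroup.subset_closure (Or.inl (Or.inr rfl))

theorem F_le {G : Subgroup (ProjClifford ω (n + 2))} (hM : M ω n ∈ G) (hY : sqrtY ω (n + 2) ∈ G)
    (htail : tailGates ω (n + 2) ⊆ G) : F ω (n + 2) ≤ G := by
  match n, G with
  | 0, G =>
    rw [F_two, Subgroup.closure_le]
    exact Set.union_subset (Set.insert_subset hM (Set.singleton_subset_iff.mpr hY)) htail
  | n + 1, G =>
    rw [F, Subgroup.closure_le]
    exact Set.union_subset (Set.singleton_subset_iff.mpr hM) htail

theorem s_zero_mem_of_sqrtPauli_mem {G : Subgroup (ProjClifford ω (n + 3))}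
    (hG : tailGates ω (n + 3) ⊆ G)
    (hZX : sqrtPauli ω (zLabel 0 + xLabel 1) ∈ unitaryPreimage G) : s ω 0 ∈ G := by
  have h01 : (0 : Fin (n + 3)) ≠ 1 := by simp
  have hval : ((2 : Fin (n + 3)) : ℕ) = 2 := Nat.mod_eq_of_lt (by omega : 2 < n + 3)
  have h02 : (0 : Fin (n + 3)) ≠ 2 := Fin.ne_of_val_ne (by rw [hval]; simp)
  have h12 : (1 : Fin (n + 3)) ≠ 2 := Fin.ne_of_val_ne (by rw [hval]; simp)
  have hz₁ : zLabel 1 ∈ supportedFrom (n + 3) 1 := zLabel_mem_supportedFrom_one (by simp)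
  have hz₂ : zLabel 2 ∈ supportedFrom (n + 3) 1 := zLabel_mem_supportedFrom_one (by omega)
  have hz₁₂ : (zLabel 1 + zLabel 2 : Label (n + 3)) ≠ 0 := fun hzero => by
    have := congrFun hzero 1
    rw [Pi.add_apply, zLabel, Pi.single_eq_same, zLabel, Pi.single_eq_of_ne h12,
      Pi.zero_apply] at this
    exact absurd this (by decide)
  have htail : ∀ v ∈ supportedFrom (n + 3) 1, sqrtPauli ω v ∈ unitaryPreimage G := fun v hv =>
    sqrtPauli_mem_of_tailGates_subset hG hv
  have hform : ∀ v ∈ supportedFrom (n + 3) 1, sympForm (zLabel 0) v = 0 := fun v hv => by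
    rw [sympForm_single_left, hv 0 Nat.one_pos]
    rfl
  have hadd : ∀ v ∈ supportedFrom (n + 3) 1, v ≠ 0 →
      sqrtPauli ω (zLabel 0 + v) ∈ unitaryPreimage G := fun v hv hv₀ =>
    (transvectionClosed_sqrtPauli (phases_le_unitaryPreimage G)).add_mem_of_add_mem htail hform
      (single_mem_supportedFrom (by simp) _) (by simp) hZX hv hv₀
  rw [← sqrtPauli_zLabel_mem_unitaryPreimage, ← Subgroup.mul_mem_cancel_right _
    (mul_mem (mul_mem (htail _ hz₁) (htail _ hz₂)) (hadd _ (add_mem hz₁ hz₂) hz₁₂)),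
    sqrtPauli_zLabel_mul_three h01 h02 h12]
  exact mul_mem (mul_mem (hadd _ hz₁ (zLabel_ne_zero 1)) (hadd _ hz₂ (zLabel_ne_zero 2)))
    (htail _ (add_mem hz₁ hz₂))

theorem mem_comap_conj {G : Type*} [Group G] {H : Subgroup G} {c g : G} :
    g ∈ H.comap (MulAut.conj c).toMonoidHom ↔ c * g * c⁻¹ ∈ H := Iff.rfl

theorem conj_mem_map_conj {G : Type*} [Group G] {H : Subgroup G} {c g : G} :
    c * g * c⁻¹ ∈ H.map (MulAut.conj c).toMonoidHom ↔ g ∈ H :=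
  Subgroup.mem_map_iff_mem (f := (MulAut.conj c).toMonoidHom) (MulAut.conj c).injective

theorem map_conj_F_le : (F ω (n + 2)).map
    (MulAut.conj (h ω (0 : Fin (n + 2)) * s ω 0)).toMonoidHom ≤
      Subgroup.centralizer {s ω (0 : Fin (n + 2))} := by
  rw [Subgroup.map_le_iff_le_comap]
  refine F_le ?_ ?_ fun g hg => ?_
  · rw [mem_comap_conj]
    exact conj_M_mem_centralizer
  · rw [mem_comap_conj, conj_sqrtY]
    exact s_mem_centralizer 0 0
  · rw [SetLike.mem_coe, mem_comap_conj, (commute_h_mul_s_of_mem_tailGates hg).mul_inv_cancel]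
    exact tailGates_subset_centralizer hg

theorem le_map_conj_F : Subgroup.centralizer {s ω (0 : Fin (n + 2))} ≤ (F ω (n + 2)).map
    (MulAut.conj (h ω (0 : Fin (n + 2)) * s ω 0)).toMonoidHom := by
  have htail : tailGates ω (n + 2) ⊆ (F ω (n + 2)).map
      (MulAut.conj (h ω (0 : Fin (n + 2)) * s ω 0)).toMonoidHom := fun g hg => by
    rw [← (commute_h_mul_s_of_mem_tailGates hg).mul_inv_cancel, SetLike.mem_coe,
      conj_mem_map_conj]
    exact tailGates_subset_F hg
  have hZX := (conj_M_mem_iff htail).mp (conj_mem_map_conj.mpr M_mem_F)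
  refine centralizer_le_of_gates htail ?_ fun _ =>
    ⟨xLabel 1, single_mem_supportedFrom (by simp) _, by simp, hZX⟩
  match n, htail, hZX with
  | 0, _, _ =>
    have hY := (conj_mem_map_conj (c := h ω (0 : Fin 2) * s ω 0)).mpr sqrtY_mem_F_two
    rwa [conj_sqrtY] at hY
  | n + 1, htail, hZX => exact s_zero_mem_of_sqrtPauli_mem htail hZX

theorem centralizer_eq_map_F (ω : EighthRoot) (n : ℕ) [hn : NeZero n] :
    Subgroup.centralizer {s ω (0 : Fin n)} =
      (F ω n).map (MulAut.conj (h ω (0 : Fin n) * s ω 0)).toMonoidHom := by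
  match n, hn with
  | 0, hn => exact absurd rfl hn.out
  | 1, _ =>
    rw [centralizer_one, F, MonoidHom.map_closure, Set.image_singleton]
    congr 2
    exact conj_sqrtY.symm
  | n + 2, _ => exact le_antisymm le_map_conj_F map_conj_F_le

theorem F_eq_centralizer (ω : EighthRoot) (n : ℕ) [NeZero n] :
    F ω n = Subgroup.centralizer {sqrtY ω n} := by
  ext g
  set c := h ω (0 : Fin n) * s ω 0
  have hcY : c * sqrtY ω n * c⁻¹ = s ω 0 := conj_sqrtY
  rw [← conj_mem_map_conj (c := c), ← centralizer_eq_map_F, ← hcY,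
    Subgroup.mem_centralizer_singleton_iff, Subgroup.mem_centralizer_singleton_iff,
    conj_mul, conj_mul, mul_left_inj, mul_right_inj]

end

/-! ### The inertia subgroup -/

section

variable {G : Type*} [Group G] {f t : G}

theorem commute_mul_of_semiconjBy_inv {a b : G} (ha : SemiconjBy a f f⁻¹)
    (hb : SemiconjBy b f f⁻¹) : Commute (a * b) f := by
  have ha' := ha.inv_right
  rw [inv_inv] at ha'
  exact ha'.mul_left hb

theorem commute_or_semiconjBy_inv_of_mem_sup (htf : SemiconjBy t f f⁻¹) {g : G}
    (hg : g ∈ Subgroup.centralizer {f} ⊔ Subgroup.closure {t}) :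
    Commute g f ∨ SemiconjBy g f f⁻¹ := by
  rw [← Subgroup.closure_eq (Subgroup.centralizer {f}), ← Subgroup.closure_union] at hg
  induction hg using Subgroup.closure_induction with
  | mem x hx =>
    rcases hx with hx | rfl
    · exact Or.inl (Subgroup.mem_centralizer_singleton_iff.mp hx)
    · exact Or.inr htf
  | one => exact Or.inl (Commute.one_left f)
  | mul x y _ _ hx hy =>
    rcases hx with hx | hx <;> rcases hy with hy | hy
    · exact Or.inl (hx.mul_left hy)
    · exact Or.inr (SemiconjBy.mul_left hx.inv_right hy)
    · exact Or.inr (SemiconjBy.mul_left hx hy)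
    · exact Or.inl (commute_mul_of_semiconjBy_inv hx hy)
  | inv x _ hx =>
    rcases hx with hx | hx
    · exact Or.inl hx.inv_left
    · exact Or.inr (by simpa only [inv_inv] using hx.inv_symm_left.inv_right)

theorem relIndex_centralizer_sup_closure (htf : SemiconjBy t f f⁻¹) (hf : f * f ≠ 1) :
    (Subgroup.centralizer {f}).relIndex (Subgroup.centralizer {f} ⊔ Subgroup.closure {t}) = 2 := by
  have not_commute {g : G} (hg : SemiconjBy g f f⁻¹) : ¬Commute g f := fun hgf =>
    hf (mul_eq_one_iff_eq_inv.mpr (mul_right_cancel (hgf.eq.symm.trans hg.eq)))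
  have ht : t ∈ Subgroup.centralizer {f} ⊔ Subgroup.closure {t} :=
    Subgroup.mem_sup_right (Subgroup.mem_closure_singleton_self t)
  refine Subgroup.relIndex_eq_two_iff.mpr ⟨t, ht, fun g hgN => ?_⟩
  simp only [Subgroup.mem_centralizer_singleton_iff, ← commute_iff_eq]
  rcases commute_or_semiconjBy_inv_of_mem_sup htf hgN with hg | hg
  · exact Or.inr ⟨hg, not_commute (SemiconjBy.mul_left hg.inv_right htf)⟩
  · exact Or.inl ⟨commute_mul_of_semiconjBy_inv hg htf, not_commute hg⟩

end

section

variable {ω : EighthRoot} {n : ℕ}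

theorem IN_two : IN ω 2 = F ω 2 ⊔ Subgroup.closure {h ω 0} := by
  have hh : h ω 0 ∈ IN ω 2 := Subgroup.subset_closure (Or.inl rfl)
  have hX : h ω 0 * s ω 0 ^ 2 * h ω 0 ∈ IN ω 2 :=
    Subgroup.subset_closure (Or.inr (Or.inr (Or.inr (Or.inl rfl))))
  have hh' : h ω 0 ∈ F ω 2 ⊔ Subgroup.closure {h ω 0} :=
    Subgroup.mem_sup_right (Subgroup.mem_closure_singleton_self _)
  apply le_antisymm
  · rw [IN, Subgroup.closure_le]
    rintro g (rfl | rfl | rfl | rfl | rfl)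
    · exact hh'
    · exact Subgroup.mem_sup_left (tailGates_subset_F ⟨1, by simp, Or.inl rfl⟩)
    · exact Subgroup.mem_sup_left (tailGates_subset_F ⟨1, by simp, Or.inr (Or.inl rfl)⟩)
    · rw [mul_assoc, ← sqrtY_eq]
      exact mul_mem hh' (Subgroup.mem_sup_left sqrtY_mem_F_two)
    · exact Subgroup.mem_sup_left M_mem_F
  · rw [sup_le_iff, Subgroup.closure_le, Set.singleton_subset_iff]
    refine ⟨F_le ?_ ?_ ?_, hh⟩
    · exact Subgroup.subset_closure (Or.inr (Or.inr (Or.inr (Or.inr rfl))))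
    · rwa [sqrtY_eq, ← Subgroup.mul_mem_cancel_left _ hh, ← mul_assoc]
    · rw [tailGates_two]
      rintro g (rfl | rfl)
      · exact Subgroup.subset_closure (Or.inr (Or.inl rfl))
      · exact Subgroup.subset_closure (Or.inr (Or.inr (Or.inl rfl)))

variable (ω n)

theorem IN_eq [hn : NeZero n] : IN ω n = F ω n ⊔ Subgroup.closure {h ω 0} := by
  match n, hn with
  | 0, hn => exact absurd rfl hn.out
  | 1, _ =>
    rw [F, ← Subgroup.closure_union, Set.union_comm]
    rfl
  | 2, _ => exact IN_two
  | n + 3, _ =>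
    rw [F, ← Subgroup.closure_union, Set.union_comm, ← Set.union_assoc, Set.singleton_union]
    rfl

theorem F_le_IN [NeZero n] : F ω n ≤ IN ω n :=
  IN_eq ω n ▸ le_sup_left

theorem relIndex_F_IN [NeZero n] : (F ω n).relIndex (IN ω n) = 2 := by
  rw [IN_eq, F_eq_centralizer]
  exact relIndex_centralizer_sup_closure semiconjBy_h_sqrtY sqrtY_mul_sqrtY_ne_one

theorem coe_centralizer_s_zero [NeZero n] :
    (Subgroup.centralizer {s ω (0 : Fin n)} : Set (ProjClifford ω n)) =
      {g | ∃ f ∈ F ω n, g = h ω 0 * s ω 0 * f * s ω 0 ^ 3 * h ω 0} := by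
  rw [centralizer_eq_map_F]
  ext g
  refine exists_congr fun f => and_congr_right fun _ => ?_
  rw [mul_assoc _ (s ω 0 ^ 3), ← inv_h_mul_s, eq_comm]
  rfl

theorem two_mul_card_centralizer_s_zero [NeZero n] :
    2 * Nat.card (Subgroup.centralizer {s ω (0 : Fin n)}) = Nat.card (IN ω n) := by
  have hcard : Nat.card (Subgroup.centralizer {s ω (0 : Fin n)}) = Nat.card (F ω n) := by
    rw [centralizer_eq_map_F]
    exact Subgroup.card_map_of_injective (MulAut.conj _).injective
  rw [hcard, mul_comm, ← Subgroup.card_mul_index ((F ω n).subgroupOf (IN ω n)),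
    Nat.card_congr (Subgroup.subgroupOfEquivOfLe (F_le_IN ω n)).toEquiv]
  exact congrArg _ (relIndex_F_IN ω n).symm

end

/-! ### Finiteness -/

section

variable {ω : EighthRoot} {n : ℕ}

theorem commute_inv_mul_of_conj_eq {G : Type*} [Group G] {a b p : G}
    (hab : a * p * a⁻¹ = b * p * b⁻¹) : Commute (a⁻¹ * b) p :=
  calc a⁻¹ * b * p = a⁻¹ * (b * p * b⁻¹) * b := by group
    _ = p * (a⁻¹ * b) := by rw [← hab]; group

theorem toProj_eq_of_conj_pauliOp_eq {A B : Clifford ω n}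
    (hx : ∀ i, A.1 * pauliOp ω (xLabel i) * A.1⁻¹ = B.1 * pauliOp ω (xLabel i) * B.1⁻¹)
    (hz : ∀ i, A.1 * pauliOp ω (zLabel i) * A.1⁻¹ = B.1 * pauliOp ω (zLabel i) * B.1⁻¹) :
    toProj A = toProj B :=
  toProj_eq_iff.mpr (mem_phases_of_mem_fixingBelow (mem_fixingBelow.mpr fun i _ =>
    ⟨commute_inv_mul_of_conj_eq (hx i), commute_inv_mul_of_conj_eq (hz i)⟩))

instance finite_projClifford (ω : EighthRoot) (n : ℕ) : Finite (ProjClifford ω n) := by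
  let signedPaulis : Set (U n) := Set.range (pauliOp ω) ∪ Set.range fun v => -pauliOp ω v
  have hmem (A : Clifford ω n) (v : Label n) : A.1 * pauliOp ω v * A.1⁻¹ ∈ signedPaulis := by
    obtain ⟨w, hw | hw⟩ := exists_conjMaps A.2 v
    · exact Or.inl ⟨w, hw.symm⟩
    · exact Or.inr ⟨w, hw.symm⟩
  have : Finite signedPaulis := Set.Finite.union (Set.finite_range _) (Set.finite_range _)
  choose rep toProj_rep using toProj_surjective (ω := ω) (n := n)
  let conjugates (g : ProjClifford ω n) (v : Label n) : signedPaulis := ⟨_, hmem (rep g) v⟩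
  have hinj : Function.Injective conjugates := fun g g' hgg' => by
    have hconj (v : Label n) := congrArg Subtype.val (congrFun hgg' v)
    rw [← toProj_rep g, ← toProj_rep g']
    exact toProj_eq_of_conj_pauliOp_eq (fun i => hconj (xLabel i)) fun i => hconj (zLabel i)
  exact Finite.of_injective conjugates hinj

end

end

end QubitClifford

theorem mainTheorem3 (ω : QubitClifford.EighthRoot) (n : ℕ) [NeZero n] :
    -- the case of one qubit
    (n = 1 →
      Subgroup.centralizer {QubitClifford.s ω (0 : Fin n)} =
        Subgroup.closure {QubitClifford.s ω (0 : Fin n)}) ∧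
    -- the case of at least two qubits, with and without the generator `s₁`
    (2 ≤ n →
      Subgroup.centralizer {QubitClifford.s ω (0 : Fin n)} =
        Subgroup.closure
          ({g | ∃ i : Fin n, i ≠ 0 ∧ g = QubitClifford.h ω i} ∪
            {g | ∃ i : Fin n, g = QubitClifford.s ω i} ∪
            {g | ∃ (i : Fin n) (hi : (i : ℕ) + 1 < n), g = QubitClifford.lam ω i hi}) ∧
      Subgroup.centralizer {QubitClifford.s ω (0 : Fin n)} =
        Subgroup.closure
          ({g | ∃ i : Fin n, i ≠ 0 ∧ g = QubitClifford.h ω i} ∪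
            {g | ∃ i : Fin n, i ≠ 0 ∧ g = QubitClifford.s ω i} ∪
            {g | ∃ (i : Fin n) (hi : (i : ℕ) + 1 < n), g = QubitClifford.lam ω i hi})) ∧
    -- the centralizer is `h₁ s₁ F s₁³ h₁`, and this is a conjugate of `F`
    (Subgroup.centralizer {QubitClifford.s ω (0 : Fin n)} : Set (QubitClifford.ProjClifford ω n)) =
      {g | ∃ f ∈ QubitClifford.F ω n,
        g = QubitClifford.h ω 0 * QubitClifford.s ω 0 * f * QubitClifford.s ω 0 ^ 3 *
          QubitClifford.h ω 0} ∧
    (∃ c : QubitClifford.ProjClifford ω n,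
      Subgroup.centralizer {QubitClifford.s ω (0 : Fin n)} =
        (QubitClifford.F ω n).map (MulAut.conj c).toMonoidHom) ∧
    -- `F` is a normal subgroup of index two of the finite group `IN`
    Finite (QubitClifford.IN ω n) ∧
    QubitClifford.F ω n ≤ QubitClifford.IN ω n ∧
    ((QubitClifford.F ω n).subgroupOf (QubitClifford.IN ω n)).Normal ∧
    (QubitClifford.F ω n).relIndex (QubitClifford.IN ω n) = 2 ∧
    -- hence the order of the centralizer
    2 * Nat.card (Subgroup.centralizer {QubitClifford.s ω (0 : Fin n)}) =
      Nat.card (QubitClifford.IN ω n) := by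
  open QubitClifford in
  refine ⟨?_, ?_, coe_centralizer_s_zero ω n, ⟨_, centralizer_eq_map_F ω n⟩, inferInstance,
    F_le_IN ω n, Subgroup.normal_of_index_eq_two (relIndex_F_IN ω n), relIndex_F_IN ω n,
    two_mul_card_centralizer_s_zero ω n⟩
  · rintro rfl
    exact centralizer_one
  · intro hn
    obtain ⟨m, rfl⟩ := Nat.exists_eq_add_of_le' hn
    exact ⟨centralizer_eq_closure_centralizerGates ω m,
      centralizer_eq_closure_reducedCentralizerGates ω m⟩
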